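/- Let $(\mathcal V,g)$ be a smooth 4-dimensional Lorentzian manifold of signature $(-,+,+,+)$ which is locally conformally flat (every point has a neighbourhood with smooth coordinates in which $g=\Omega\,\eta$, where $\Omega>0$ is smooth and $\eta$ is the Minkowski metric) or has constant curvature (a Lorentz space form). Let $\Phi:S\to\mathcal V$ be a smooth spacelike immersed surface, that is, an immersion of a smooth 2-manifold such that $\Phi^*g$ is positive definite. Let $\nabla$ be the Levi-Civita connection of $g$. For a normal field $N$ and tangent fields $X,Y$ of $S$ let $A_N(X)=(\nabla_XN)^T$ be the Weingarten operator, $D_XN=(\nabla_XN)^\perp$ the normal connection, and $R^\perp(X,Y)N=D_XD_YN-D_YD_XN-D_{[X,Y]}N$ the normal curvature. A point $x\in S$ is called umbilical with respect to a normal vector $n\in T_xS^\perp$ if $A_n|_x=\tfrac12F\,\mathbf 1$ for some number $F$; it is umbilical along a normal direction if this holds for some $n\neq0$, and totally umbilical if it holds for all $n\in T_xS^\perp$. 1. $S$ is umbilical along a normal direction (at each of its points) if and only if $R^\perp=0$ on $S$. 2. More precisely, for each point $x\in S$: $x$ is umbilical along a normal direction if and only if $R^\perp|_x=0$. 3. If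 $x\in S$ is not totally umbilical, then $S$ is umbilical along some smooth nowhere vanishing normal vector field on a neighbourhood of $x$ if and only if $R^\perp=0$ on a neighbourhood of $x$. -/

import Mathlib

open scoped Manifold ContDiff Topology

attribute [-instance] TopCat.of.chartedSpace TopCat.of.hasGroupoid

noncomputable section

namespace SpacetimeSurface

/-- The model space of a 4-manifold. -/
abbrev E4 : Type := EuclideanSpace ℝ (Fin 4)

/-- The model space of a surface. -/
abbrev E2 : Type := EuclideanSpace ℝ (Fin 2)

/-- The Minkowski scalar product of signature `(-,+,+,+)` on `ℝ⁴`. -/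
def minkowski (a b : E4) : ℝ := -(a 0 * b 0) + a 1 * b 1 + a 2 * b 2 + a 3 * b 3

/-- A smooth Lorentzian metric of signature `(-,+,+,+)` on a 4-manifold `V`. -/
structure LorentzMetric (V : Type*) [TopologicalSpace V] [ChartedSpace E4 V]
    [IsManifold (𝓡 4) ∞ V] where
  /-- the scalar product on each tangent space -/
  val : ∀ p : V, TangentSpace (𝓡 4) p →L[ℝ] TangentSpace (𝓡 4) p →L[ℝ] ℝ
  symm : ∀ (p : V) (v w : TangentSpace (𝓡 4) p), val p v w = val p w v
  signature : ∀ p : V, ∃ L : TangentSpace (𝓡 4) p ≃ₗ[ℝ] E4,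
    ∀ v w : TangentSpace (𝓡 4) p, val p v w = minkowski (L v) (L w)
  contMDiff : ContMDiff (𝓡 4) ((𝓡 4).prod 𝓘(ℝ, E4 →L[ℝ] E4 →L[ℝ] ℝ)) ∞
    (fun p ↦ Bundle.TotalSpace.mk' (E4 →L[ℝ] E4 →L[ℝ] ℝ)
      (E := fun p : V ↦ TangentSpace (𝓡 4) p →L[ℝ] TangentSpace (𝓡 4) p →L[ℝ] ℝ) p (val p))

section Spacetime

variable {V : Type*} [TopologicalSpace V] [ChartedSpace E4 V] [IsManifold (𝓡 4) ∞ V]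

/-- The components of tangent vectors at `q` in the chart `e`, that is, the differential of `e`. -/
def coord (e : OpenPartialHomeomorph V E4) (q : V) : TangentSpace (𝓡 4) q →L[ℝ] E4 :=
  mfderiv (𝓡 4) 𝓘(ℝ, E4) e q

/-- The coordinate components `g_ij` of the metric in the chart `e`, as a matrix-valued function
on `ℝ⁴` (meaningful on the target of `e`). -/
def metricMatrix (g : LorentzMetric V) (e : OpenPartialHomeomorph V E4) (y : E4) :
    Matrix (Fin 4) (Fin 4) ℝ :=
  Matrix.of fun i j ↦ g.val (e.symm y)
    ((coord e (e.symm y)).inverse (EuclideanSpace.single i 1))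
    ((coord e (e.symm y)).inverse (EuclideanSpace.single j 1))

/-- The partial derivative `∂_i g_jk` in the chart `e`. -/
def dMetric (g : LorentzMetric V) (e : OpenPartialHomeomorph V E4) (y : E4) (i j k : Fin 4) : ℝ :=
  fderiv ℝ (fun z ↦ metricMatrix g e z j k) y (EuclideanSpace.single i 1)

/-- The Christoffel symbols `Γ^k_ij = ½ g^{kl} (∂_i g_jl + ∂_j g_il - ∂_l g_ij)` of the Levi-Civita
connection in the chart `e`. -/
def christoffelSymbol (g : LorentzMetric V) (e : OpenPartialHomeomorph V E4) (y : E4)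
    (k i j : Fin 4) : ℝ :=
  (1 / 2 : ℝ) * ∑ l, (metricMatrix g e y)⁻¹ k l *
    (dMetric g e y i j l + dMetric g e y j i l - dMetric g e y l i j)

/-- The Christoffel symbols contracted with two vectors: `Γ^k_ij a^i b^j`. -/
def christoffel (g : LorentzMetric V) (e : OpenPartialHomeomorph V E4) (y a b : E4) : E4 :=
  WithLp.toLp 2 fun k ↦ ∑ i, ∑ j, christoffelSymbol g e y k i j * a i * b j

/-- The Riemann tensor in the chart `e`, with the convention
`R(X,Y)Z = ∇_X ∇_Y Z - ∇_Y ∇_X Z - ∇_[X,Y] Z`. -/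
def riemannIn (g : LorentzMetric V) (e : OpenPartialHomeomorph V E4) (y a b c : E4) : E4 :=
  fderiv ℝ (fun z ↦ christoffel g e z b c) y a - fderiv ℝ (fun z ↦ christoffel g e z a c) y b
    + christoffel g e y a (christoffel g e y b c) - christoffel g e y b (christoffel g e y a c)

/-- The Riemann tensor `R(u,v)w` at `p`. -/
def riemann (g : LorentzMetric V) (p : V) (u v w : TangentSpace (𝓡 4) p) :
    TangentSpace (𝓡 4) p :=
  (coord (chartAt E4 p) p).inverse
    (riemannIn g (chartAt E4 p) (chartAt E4 p p) (coord (chartAt E4 p) p u)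
      (coord (chartAt E4 p) p v) (coord (chartAt E4 p) p w))

/-- `(V, g)` has constant curvature `K`. -/
def HasConstantCurvature (g : LorentzMetric V) (K : ℝ) : Prop :=
  ∀ (p : V) (u v w : TangentSpace (𝓡 4) p),
    riemann g p u v w = K • (g.val p v w • u - g.val p u w • v)

/-- `(V, g)` is locally conformally flat: around every point there are smooth coordinates in which
the metric is a positive smooth function times the Minkowski metric. -/
def IsLocallyConformallyFlat (g : LorentzMetric V) : Prop :=
  ∀ p : V, ∃ e ∈ IsManifold.maximalAtlas (𝓡 4) ∞ V, p ∈ e.source ∧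
    ∃ Ω : V → ℝ, ContMDiffOn (𝓡 4) 𝓘(ℝ) ∞ Ω e.source ∧
      ∀ q ∈ e.source, 0 < Ω q ∧ ∀ v w : TangentSpace (𝓡 4) q,
        g.val q v w = Ω q * minkowski (coord e q v) (coord e q w)

end Spacetime

section Surface

variable {V : Type*} [TopologicalSpace V] [ChartedSpace E4 V] [IsManifold (𝓡 4) ∞ V]
variable {S : Type*} [TopologicalSpace S] [ChartedSpace E2 S] [IsManifold (𝓡 2) ∞ S]

/-- The differential of `Φ` at `x`. -/
def diff (Φ : S → V) (x : S) : TangentSpace (𝓡 2) x →L[ℝ] TangentSpace (𝓡 4) (Φ x) :=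
  mfderiv (𝓡 2) (𝓡 4) Φ x

/-- `Φ` is a smooth immersion and the first fundamental form `Φ^* g` is positive definite. -/
structure IsSpacelikeImmersion (g : LorentzMetric V) (Φ : S → V) : Prop where
  smooth : ContMDiff (𝓡 2) (𝓡 4) ∞ Φ
  immersion : ∀ x : S, Function.Injective (diff Φ x)
  spacelike : ∀ (x : S) (u : TangentSpace (𝓡 2) x), u ≠ 0 →
    0 < g.val (Φ x) (diff Φ x u) (diff Φ x u)

/-- The `i`-th coordinate vector in `T_x S`. -/
def basisVec (x : S) (i : Fin 2) : TangentSpace (𝓡 2) x :=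
  (EuclideanSpace.single i 1 : E2)

/-- The components of the first fundamental form at `x`. -/
def firstFundamentalMatrix (g : LorentzMetric V) (Φ : S → V) (x : S) :
    Matrix (Fin 2) (Fin 2) ℝ :=
  Matrix.of fun i j ↦ g.val (Φ x) (diff Φ x (basisVec x i)) (diff Φ x (basisVec x j))

/-- The tangential part `v^T` of `v ∈ T_{Φ x} V`, as a vector in `T_x S`. -/
def tangentPart (g : LorentzMetric V) (Φ : S → V) (x : S) (v : TangentSpace (𝓡 4) (Φ x)) :
    TangentSpace (𝓡 2) x :=
  ∑ i, (∑ j, (firstFundamentalMatrix g Φ x)⁻¹ i j * g.val (Φ x) (diff Φ x (basisVec x j)) v) •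
    basisVec x i

/-- The normal part `v^⊥` of `v ∈ T_{Φ x} V`. -/
def normalPart (g : LorentzMetric V) (Φ : S → V) (x : S) (v : TangentSpace (𝓡 4) (Φ x)) :
    TangentSpace (𝓡 4) (Φ x) :=
  v - diff Φ x (tangentPart g Φ x v)

/-- `v ∈ T_{Φ x} V` is orthogonal to the surface. -/
def IsNormal (g : LorentzMetric V) (Φ : S → V) (x : S) (v : TangentSpace (𝓡 4) (Φ x)) : Prop :=
  ∀ u : TangentSpace (𝓡 2) x, g.val (Φ x) v (diff Φ x u) = 0

/-- The derivative `u(Z^k)` at `x` of the components, in the chart of `V` around `Φ x`, of a field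
`Z` along `Φ`. -/
def dComponents (Φ : S → V) (Z : ∀ y : S, TangentSpace (𝓡 4) (Φ y)) (x : S)
    (u : TangentSpace (𝓡 2) x) : E4 :=
  mfderiv (𝓡 2) 𝓘(ℝ, E4) (fun y : S ↦ coord (chartAt E4 (Φ x)) (Φ y) (Z y)) x u

/-- The Levi-Civita derivative `∇_u Z` at `x` of a field `Z` along `Φ` in the direction
`u ∈ T_x S`; in coordinates `u(Z^k) + Γ^k_ij (dΦ u)^i Z^j`. -/
def covAlong (g : LorentzMetric V) (Φ : S → V) (Z : ∀ y : S, TangentSpace (𝓡 4) (Φ y)) (x : S)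
    (u : TangentSpace (𝓡 2) x) : TangentSpace (𝓡 4) (Φ x) :=
  (coord (chartAt E4 (Φ x)) (Φ x)).inverse
    (dComponents Φ Z x u
      + christoffel g (chartAt E4 (Φ x)) (chartAt E4 (Φ x) (Φ x))
          (coord (chartAt E4 (Φ x)) (Φ x) (diff Φ x u)) (coord (chartAt E4 (Φ x)) (Φ x) (Z x)))

/-- The Weingarten operator `A_N u = (∇_u N)^T` at `x`. -/
def weingarten (g : LorentzMetric V) (Φ : S → V) (N : ∀ y : S, TangentSpace (𝓡 4) (Φ y)) (x : S)
    (u : TangentSpace (𝓡 2) x) : TangentSpace (𝓡 2) x :=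
  tangentPart g Φ x (covAlong g Φ N x u)

/-- The normal connection `D_X N = (∇_X N)^⊥`. -/
def normalCov (g : LorentzMetric V) (Φ : S → V) (X : ∀ y : S, TangentSpace (𝓡 2) y)
    (N : ∀ y : S, TangentSpace (𝓡 4) (Φ y)) : ∀ y : S, TangentSpace (𝓡 4) (Φ y) :=
  fun y ↦ normalPart g Φ y (covAlong g Φ N y (X y))

/-- The normal curvature `R^⊥(X,Y)N = D_X D_Y N - D_Y D_X N - D_[X,Y] N`. -/
def normalCurvature (g : LorentzMetric V) (Φ : S → V) (X Y : ∀ y : S, TangentSpace (𝓡 2) y)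
    (N : ∀ y : S, TangentSpace (𝓡 4) (Φ y)) : ∀ y : S, TangentSpace (𝓡 4) (Φ y) :=
  fun y ↦ normalCov g Φ X (normalCov g Φ Y N) y - normalCov g Φ Y (normalCov g Φ X N) y
    - normalCov g Φ (VectorField.mlieBracket (𝓡 2) X Y) N y

/-- `X` is a smooth tangent vector field of `S` on a neighbourhood of `x`. -/
def IsTangentFieldNear (X : ∀ y : S, TangentSpace (𝓡 2) y) (x : S) : Prop :=
  ∀ᶠ y in 𝓝 x, ContMDiffAt (𝓡 2) (𝓡 2).tangent ∞
    (fun z : S ↦ (⟨z, X z⟩ : TangentBundle (𝓡 2) S)) y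

/-- `N` is a smooth normal vector field along the surface on a neighbourhood of `x`. -/
def IsNormalFieldNear (g : LorentzMetric V) (Φ : S → V) (N : ∀ y : S, TangentSpace (𝓡 4) (Φ y))
    (x : S) : Prop :=
  ∀ᶠ y in 𝓝 x, IsNormal g Φ y (N y) ∧ ContMDiffAt (𝓡 2) (𝓡 4).tangent ∞
    (fun z : S ↦ (⟨Φ z, N z⟩ : TangentBundle (𝓡 4) V)) y

/-- `R^⊥ = 0` at `x`. -/
def NormalCurvatureVanishesAt (g : LorentzMetric V) (Φ : S → V) (x : S) : Prop :=
  ∀ (X Y : ∀ y : S, TangentSpace (𝓡 2) y) (N : ∀ y : S, TangentSpace (𝓡 4) (Φ y)),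
    IsTangentFieldNear X x → IsTangentFieldNear Y x → IsNormalFieldNear g Φ N x →
      normalCurvature g Φ X Y N x = 0

/-- `A_N = ½ F 1` at `x`, for some number `F`. -/
def WeingartenIsScalarAt (g : LorentzMetric V) (Φ : S → V)
    (N : ∀ y : S, TangentSpace (𝓡 4) (Φ y)) (x : S) : Prop :=
  ∃ F : ℝ, ∀ u : TangentSpace (𝓡 2) x, weingarten g Φ N x u = ((1 / 2 : ℝ) * F) • u

/-- The point `x` is umbilical with respect to the normal vector `n` at `x`: the Weingarten operator
of `n` is a multiple of the identity. (It is computed from any normal field extending `n`.) -/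
def IsUmbilicalPoint (g : LorentzMetric V) (Φ : S → V) (x : S) (n : TangentSpace (𝓡 4) (Φ x)) :
    Prop :=
  ∃ N : ∀ y : S, TangentSpace (𝓡 4) (Φ y),
    IsNormalFieldNear g Φ N x ∧ N x = n ∧ WeingartenIsScalarAt g Φ N x

/-- At the point `x` the surface is umbilical along some normal direction. -/
def IsUmbilicalAlongDirectionAt (g : LorentzMetric V) (Φ : S → V) (x : S) : Prop :=
  ∃ n : TangentSpace (𝓡 4) (Φ x), n ≠ 0 ∧ IsUmbilicalPoint g Φ x n

/-- The surface is totally umbilical at the point `x`. -/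
def IsTotallyUmbilicalAt (g : LorentzMetric V) (Φ : S → V) (x : S) : Prop :=
  ∀ n : TangentSpace (𝓡 4) (Φ x), IsNormal g Φ x n → IsUmbilicalPoint g Φ x n

/-- On a neighbourhood of `x` the surface is umbilical along a smooth nowhere vanishing normal
vector field. -/
def IsUmbilicalAlongFieldNear (g : LorentzMetric V) (Φ : S → V) (x : S) : Prop :=
  ∃ N : ∀ y : S, TangentSpace (𝓡 4) (Φ y), IsNormalFieldNear g Φ N x ∧
    ∀ᶠ y in 𝓝 x, N y ≠ 0 ∧ WeingartenIsScalarAt g Φ N y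

end Surface

end SpacetimeSurface

end

/-! For a normal vector `n` let `h_n(u,v) = ⟨n, II(u,v)⟩`, where the second fundamental form `II` is
the normal part of the covariant Hessian of the immersion. The Weingarten equation says that `A_n`
is minus the metric dual of `h_n`, so `n` is an umbilical direction exactly when `h_n` is a multiple
of the first fundamental form.

The Ricci equation (`metric_normalCurvature`) expresses `⟨R^⊥(X,Y)N, m⟩` as `⟨R(X,Y)N, m⟩` plus a
term that is, up to sign, the commutator of `A_N` and `A_m`. If the spacetime is conformally flat or
of constant curvature, the ambient term vanishes for `X, Y` tangent and `N, m` normal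
(`exists_chart_curvaturePreservesSplitting`). Hence `R^⊥ = 0` at a point iff all Weingarten
operators there commute.

On a Euclidean plane, self-adjoint operators commute iff their trace-free parts are proportional.
The normal space is also a plane, and `n ↦` (trace-free part of `A_n`) is a linear map between
two-dimensional spaces. Its values are pairwise proportional iff its rank is at most one, that is,
iff its kernel, the set of umbilical normal vectors, is nonzero. `normalCurvature_eq_zero` and
`shear_mul_shear` are the two directions of this equivalence. The argument uses only nondegeneracy
of the spacetime metric and positivity of the first fundamental form.

At a point that is not totally umbilical the rank is exactly one. Some component of the trace-free
part is then a nonzero functional on the normal plane, and an explicit smooth formula gives its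
kernel (`exists_umbilic_field`), which yields the field version.

All of this is proved for a map between vector spaces with a coordinate metric. The rest of the
argument identifies the manifold notions with their coordinate expressions; the chart of the
spacetime must be arbitrary, since conformally flat coordinates need not be a preferred chart. -/

set_option maxSynthPendingDepth 3

noncomputable section

namespace LocalSurface

open VectorField

/-! ### Submanifold calculus in coordinates: Weingarten and Ricci equations. -/

section Calculus

variable {D E : Type*} [NormedAddCommGroup D] [NormedSpace ℝ D]
  [NormedAddCommGroup E] [NormedSpace ℝ E]

/-- The first fundamental form of `f : D → E` with respect to the metric `G` on `E`. -/
def firstForm (G : E → E →L[ℝ] E →L[ℝ] ℝ) (f : D → E) (s : D) : D →L[ℝ] D →L[ℝ] ℝ :=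
  (G (f s)).bilinearComp (fderiv ℝ f s) (fderiv ℝ f s)

/-- The tangential part of a vector at a point of the immersed surface `f`. -/
def tangentPart (G : E → E →L[ℝ] E →L[ℝ] ℝ) (f : D → E) (s : D) (v : E) : D :=
  (firstForm G f s).inverse ((G (f s) v).comp (fderiv ℝ f s))

/-- The normal part of a vector at a point of the immersed surface `f`. -/
def normalPart (G : E → E →L[ℝ] E →L[ℝ] ℝ) (f : D → E) (s : D) (v : E) : E :=
  v - fderiv ℝ f s (tangentPart G f s v)

/-- The covariant Hessian of `f`. -/
def hessian (Γ : E → E →L[ℝ] E →L[ℝ] E) (f : D → E) (s u v : D) : E :=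
  fderiv ℝ (fderiv ℝ f) s u v + Γ (f s) (fderiv ℝ f s u) (fderiv ℝ f s v)

/-- The covariant derivative of a vector field along `f`. -/
def cov (Γ : E → E →L[ℝ] E →L[ℝ] E) (f : D → E) (N : D → E) (s u : D) : E :=
  fderiv ℝ N s u + Γ (f s) (fderiv ℝ f s u) (N s)

/-- The normal covariant derivative of a vector field along `f`. -/
def normalCov (G : E → E →L[ℝ] E →L[ℝ] ℝ) (Γ : E → E →L[ℝ] E →L[ℝ] E) (f : D → E)
    (X : D → D) (N : D → E) (s : D) : E :=
  normalPart G f s (cov Γ f N s (X s))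

/-- The curvature of the normal connection of `f`. -/
def normalCurvature (G : E → E →L[ℝ] E →L[ℝ] ℝ) (Γ : E → E →L[ℝ] E →L[ℝ] E) (f : D → E)
    (X Y : D → D) (N : D → E) (s : D) : E :=
  normalCov G Γ f X (normalCov G Γ f Y N) s - normalCov G Γ f Y (normalCov G Γ f X N) s
    - normalCov G Γ f (lieBracket ℝ X Y) N s

/-- The curvature of the connection with Christoffel symbols `Γ`. -/
def curvature (Γ : E → E →L[ℝ] E →L[ℝ] E) (z a b c : E) : E :=
  fderiv ℝ Γ z a b c - fderiv ℝ Γ z b a c + Γ z a (Γ z b c) - Γ z b (Γ z a c)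

/-- `Γ` is the smooth Levi-Civita connection of the smooth metric `G` on the open set `W`, and
`f` is a smooth immersion of the open set `U` into `W` with positive first fundamental form. -/
structure IsImmersion (G : E → E →L[ℝ] E →L[ℝ] ℝ) (Γ : E → E →L[ℝ] E →L[ℝ] E) (f : D → E)
    (U : Set D) (W : Set E) : Prop where
  isOpen_source : IsOpen U
  isOpen_target : IsOpen W
  mapsTo : Set.MapsTo f U W
  contDiffOn_metric : ContDiffOn ℝ ∞ G W
  contDiffOn_christoffel : ContDiffOn ℝ ∞ Γ W
  contDiffOn : ContDiffOn ℝ ∞ f U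
  metric_symm : ∀ z ∈ W, ∀ a b, G z a b = G z b a
  christoffel_symm : ∀ z ∈ W, ∀ a b, Γ z a b = Γ z b a
  fderiv_metric : ∀ z ∈ W, ∀ a b c, fderiv ℝ G z a b c = G z (Γ z a b) c + G z b (Γ z a c)
  pos : ∀ s ∈ U, ∀ u, u ≠ 0 → 0 < G (f s) (fderiv ℝ f s u) (fderiv ℝ f s u)

namespace IsImmersion

variable {G : E → E →L[ℝ] E →L[ℝ] ℝ} {Γ : E → E →L[ℝ] E →L[ℝ] E} {f : D → E}
  {U : Set D} {W : Set E} {s : D}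

theorem contDiffAt (h : IsImmersion G Γ f U W) (hs : s ∈ U) : ContDiffAt ℝ ∞ f s :=
  h.contDiffOn.contDiffAt (h.isOpen_source.mem_nhds hs)

theorem contDiffAt_fderiv (h : IsImmersion G Γ f U W) (hs : s ∈ U) :
    ContDiffAt ℝ ∞ (fderiv ℝ f) s :=
  (h.contDiffAt hs).fderiv_right (by simp)

theorem contDiffAt_metric (h : IsImmersion G Γ f U W) (hs : s ∈ U) : ContDiffAt ℝ ∞ G (f s) :=
  h.contDiffOn_metric.contDiffAt (h.isOpen_target.mem_nhds (h.mapsTo hs))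

theorem contDiffAt_christoffel (h : IsImmersion G Γ f U W) (hs : s ∈ U) :
    ContDiffAt ℝ ∞ Γ (f s) :=
  h.contDiffOn_christoffel.contDiffAt (h.isOpen_target.mem_nhds (h.mapsTo hs))

theorem contDiffAt_metric_comp (h : IsImmersion G Γ f U W) (hs : s ∈ U) :
    ContDiffAt ℝ ∞ (fun s ↦ G (f s)) s :=
  (h.contDiffAt_metric hs).comp s (h.contDiffAt hs)

theorem contDiffAt_christoffel_comp (h : IsImmersion G Γ f U W) (hs : s ∈ U) :
    ContDiffAt ℝ ∞ (fun s ↦ Γ (f s)) s :=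
  (h.contDiffAt_christoffel hs).comp s (h.contDiffAt hs)

theorem firstForm_bijective [FiniteDimensional ℝ D] (h : IsImmersion G Γ f U W) (hs : s ∈ U) :
    Function.Bijective (firstForm G f s : D → D →L[ℝ] ℝ) := by
  have hinj : Function.Injective ((firstForm G f s : D →L[ℝ] D →L[ℝ] ℝ) : D →ₗ[ℝ] D →L[ℝ] ℝ) := by
    rw [injective_iff_map_eq_zero]
    intro u hu
    by_contra hne
    have h1 := h.pos s hs u hne
    have h2 : firstForm G f s u u = 0 := by
      have : firstForm G f s u = 0 := hu
      rw [this]; rfl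
    simp only [firstForm, ContinuousLinearMap.bilinearComp_apply] at h2
    exact h1.ne' h2
  refine ⟨hinj, ?_⟩
  have hrank : Module.finrank ℝ D = Module.finrank ℝ (D →L[ℝ] ℝ) := by
    rw [← LinearEquiv.finrank_eq (LinearMap.toContinuousLinearMap (𝕜 := ℝ) (E := D) (F' := ℝ)),
      Module.finrank_linearMap, Module.finrank_self, mul_one]
  exact (LinearMap.injective_iff_surjective_of_finrank_eq_finrank hrank).1 hinj

theorem isInvertible_firstForm [FiniteDimensional ℝ D] (h : IsImmersion G Γ f U W) (hs : s ∈ U) :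
    (firstForm G f s).IsInvertible := by
  have hb := h.firstForm_bijective hs
  let L : D ≃ₗ[ℝ] (D →L[ℝ] ℝ) :=
    LinearEquiv.ofBijective ((firstForm G f s : D →L[ℝ] D →L[ℝ] ℝ) : D →ₗ[ℝ] D →L[ℝ] ℝ) hb
  exact ⟨L.toContinuousLinearEquiv, by ext u v; rfl⟩

theorem firstForm_tangentPart [FiniteDimensional ℝ D] (h : IsImmersion G Γ f U W) (hs : s ∈ U) (v : E) (u : D) :
    G (f s) (fderiv ℝ f s (tangentPart G f s v)) (fderiv ℝ f s u) = G (f s) v (fderiv ℝ f s u) := by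
  obtain ⟨L, hL⟩ := h.isInvertible_firstForm hs
  have : firstForm G f s (tangentPart G f s v) = (G (f s) v).comp (fderiv ℝ f s) := by
    rw [tangentPart, ← hL, ContinuousLinearMap.inverse_equiv]
    simp
  have := congrArg (fun l : D →L[ℝ] ℝ ↦ l u) this
  simpa [firstForm] using this

/-- Uniqueness follows from injectivity of the first fundamental form. This characterization lets
other descriptions of the tangential part be identified with this one. -/
theorem tangentPart_eq_of_forall [FiniteDimensional ℝ D] (h : IsImmersion G Γ f U W) (hs : s ∈ U) {v : E} {t : D}
    (ht : ∀ u, G (f s) (fderiv ℝ f s t) (fderiv ℝ f s u) = G (f s) v (fderiv ℝ f s u)) :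
    tangentPart G f s v = t := by
  apply (h.firstForm_bijective hs).1
  ext u
  have := (h.firstForm_tangentPart hs v u).trans (ht u).symm
  simpa [firstForm] using this

theorem normalPart_orthogonal [FiniteDimensional ℝ D] (h : IsImmersion G Γ f U W) (hs : s ∈ U) (v : E) (u : D) :
    G (f s) (normalPart G f s v) (fderiv ℝ f s u) = 0 := by
  simp [normalPart, h.firstForm_tangentPart hs]

theorem metric_normalPart (h : IsImmersion G Γ f U W) (hs : s ∈ U) (v : E) {m : E}
    (hm : ∀ u, G (f s) m (fderiv ℝ f s u) = 0) :
    G (f s) (normalPart G f s v) m = G (f s) v m := by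
  simp [normalPart, h.metric_symm _ (h.mapsTo hs) (fderiv ℝ f s _) m, hm]

theorem normalPart_eq_self [FiniteDimensional ℝ D] (h : IsImmersion G Γ f U W) (hs : s ∈ U) {m : E}
    (hm : ∀ u, G (f s) m (fderiv ℝ f s u) = 0) : normalPart G f s m = m := by
  have : tangentPart G f s m = 0 := h.tangentPart_eq_of_forall hs fun u ↦ by simp [hm]
  simp [normalPart, this]

/-- Inversion of continuous linear maps is smooth at invertible ones, and the first fundamental form
is invertible at every point of the domain. -/
theorem contDiffAt_tangentPart [FiniteDimensional ℝ D] (h : IsImmersion G Γ f U W) (hs : s ∈ U) {v : D → E}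
    (hv : ContDiffAt ℝ ∞ v s) : ContDiffAt ℝ ∞ (fun s ↦ tangentPart G f s (v s)) s := by
  have hG := h.contDiffAt_metric_comp hs
  have hf := h.contDiffAt_fderiv hs
  have hF : ContDiffAt ℝ ∞ (firstForm G f) s := by
    have : firstForm G f = fun s ↦ ((ContinuousLinearMap.compL ℝ D E ℝ).flip (fderiv ℝ f s)).comp
        ((G (f s)).comp (fderiv ℝ f s)) := by
      ext s u w; simp [firstForm]
    rw [this]
    exact (ContDiffAt.clm_apply contDiffAt_const hf).clm_comp (hG.clm_comp hf)
  obtain ⟨L, hL⟩ := h.isInvertible_firstForm hs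
  have hI : ContDiffAt ℝ ∞ (fun s ↦ (firstForm G f s).inverse) s := by
    have h1 : ContDiffAt ℝ ∞ ContinuousLinearMap.inverse (firstForm G f s) := by
      rw [← hL]; exact contDiffAt_map_inverse L
    exact h1.comp s hF
  exact hI.clm_apply ((hG.clm_apply hv).clm_comp hf)

theorem contDiffAt_normalPart [FiniteDimensional ℝ D] (h : IsImmersion G Γ f U W) (hs : s ∈ U) {v : D → E}
    (hv : ContDiffAt ℝ ∞ v s) : ContDiffAt ℝ ∞ (fun s ↦ normalPart G f s (v s)) s :=
  hv.sub ((h.contDiffAt_fderiv hs).clm_apply (h.contDiffAt_tangentPart hs hv))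

theorem contDiffAt_cov (h : IsImmersion G Γ f U W) (hs : s ∈ U) {N : D → E} {X : D → D}
    (hN : ContDiffAt ℝ ∞ N s) (hX : ContDiffAt ℝ ∞ X s) :
    ContDiffAt ℝ ∞ (fun s ↦ cov Γ f N s (X s)) s :=
  ((hN.fderiv_right (by simp)).clm_apply hX).add
    (((h.contDiffAt_christoffel_comp hs).clm_apply ((h.contDiffAt_fderiv hs).clm_apply hX)).clm_apply
      hN)

theorem contDiffAt_hessian (h : IsImmersion G Γ f U W) (hs : s ∈ U) (u v : D) :
    ContDiffAt ℝ ∞ (fun s ↦ hessian Γ f s u v) s := by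
  have hf := h.contDiffAt_fderiv hs
  have hf2 : ContDiffAt ℝ ∞ (fderiv ℝ (fderiv ℝ f)) s := hf.fderiv_right (by simp)
  exact ((hf2.clm_apply contDiffAt_const).clm_apply contDiffAt_const).add
    (((h.contDiffAt_christoffel_comp hs).clm_apply (hf.clm_apply contDiffAt_const)).clm_apply
      (hf.clm_apply contDiffAt_const))

/-- Second derivatives commute and the connection is torsion-free. -/
theorem hessian_symm (h : IsImmersion G Γ f U W) (hs : s ∈ U) (u v : D) :
    hessian Γ f s u v = hessian Γ f s v u := by
  have h1 : IsSymmSndFDerivAt ℝ f s := (h.contDiffAt hs).isSymmSndFDerivAt (by simp; exact WithTop.coe_le_coe.2 (le_top (a := (2 : ℕ∞))))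
  rw [hessian, hessian, h.christoffel_symm _ (h.mapsTo hs), h1.eq]

/-- The Weingarten equation. -/
theorem metric_cov_fderiv (h : IsImmersion G Γ f U W) (hs : s ∈ U) {N : D → E}
    (hN : ContDiffAt ℝ ∞ N s) (hn : ∀ᶠ y in 𝓝 s, ∀ u, G (f y) (N y) (fderiv ℝ f y u) = 0) (u v : D) :
    G (f s) (cov Γ f N s u) (fderiv ℝ f s v) = - G (f s) (N s) (hessian Γ f s u v) := by
  have hz := h.mapsTo hs
  have hfd := ((h.contDiffAt hs).differentiableAt (by simp)).hasFDerivAt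
  have hf2 := ((h.contDiffAt_fderiv hs).differentiableAt (by simp)).hasFDerivAt
  have hG := ((h.contDiffAt_metric hs).differentiableAt (by simp)).hasFDerivAt.comp s hfd
  have hN' := (hN.differentiableAt (by simp)).hasFDerivAt
  have h1 := (hG.clm_apply hN').clm_apply (hf2.clm_apply (hasFDerivAt_const v s))
  -- The product `⟨N, df v⟩` vanishes near `s`, so its derivative does too. Metric compatibility
  -- turns the product rule into the claim.
  have h0 : HasFDerivAt (fun y ↦ G (f y) (N y) (fderiv ℝ f y v)) (0 : D →L[ℝ] ℝ) s :=
    (hasFDerivAt_const (0 : ℝ) s).congr_of_eventuallyEq (hn.mono fun y hy ↦ hy v)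
  have h2 := congrArg (fun l : D →L[ℝ] ℝ ↦ l u) (h1.unique h0)
  simp [h.fderiv_metric _ hz] at h2
  simp [cov, hessian]
  linarith

/-- The derivative of a tangential field splits into its tangential part and the Hessian. -/
theorem cov_fderiv (h : IsImmersion G Γ f U W) (hs : s ∈ U) {T : D → D}
    (hT : DifferentiableAt ℝ T s) (u : D) :
    cov Γ f (fun s ↦ fderiv ℝ f s (T s)) s u
      = hessian Γ f s u (T s) + fderiv ℝ f s (fderiv ℝ T s u) := by
  have hf2 := ((h.contDiffAt_fderiv hs).differentiableAt (by simp)).hasFDerivAt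
  have h1 := (hf2.clm_apply hT.hasFDerivAt).fderiv
  simp only [cov, hessian, h1]
  simp
  abel

theorem cov_sub {N M : D → E} (hN : DifferentiableAt ℝ N s) (hM : DifferentiableAt ℝ M s) (u : D) :
    cov Γ f (fun s ↦ N s - M s) s u = cov Γ f N s u - cov Γ f M s u := by
  simp only [cov, fderiv_fun_sub hN hM, map_sub]
  simp
  abel

/-- The curvature as the commutator of covariant derivatives along `f`. -/
theorem cov_cov_sub (h : IsImmersion G Γ f U W) (hs : s ∈ U) {N : D → E} {X Y : D → D}
    (hN : ContDiffAt ℝ ∞ N s) (hX : ContDiffAt ℝ ∞ X s) (hY : ContDiffAt ℝ ∞ Y s) :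
    cov Γ f (fun s ↦ cov Γ f N s (Y s)) s (X s) - cov Γ f (fun s ↦ cov Γ f N s (X s)) s (Y s)
      - cov Γ f N s (lieBracket ℝ X Y s)
      = curvature Γ (f s) (fderiv ℝ f s (X s)) (fderiv ℝ f s (Y s)) (N s) := by
  have hz := h.mapsTo hs
  have hfd := ((h.contDiffAt hs).differentiableAt (by simp)).hasFDerivAt
  have hf2 := ((h.contDiffAt_fderiv hs).differentiableAt (by simp)).hasFDerivAt
  have hΓ := ((h.contDiffAt_christoffel hs).differentiableAt (by simp)).hasFDerivAt.comp s hfd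
  have hN1 := (hN.differentiableAt (by simp)).hasFDerivAt
  have hN2 : HasFDerivAt (fderiv ℝ N) (fderiv ℝ (fderiv ℝ N) s) s :=
    ((hN.fderiv_right (m := ∞) (by simp)).differentiableAt (by simp)).hasFDerivAt
  have hX1 := (hX.differentiableAt (by simp)).hasFDerivAt
  have hY1 := (hY.differentiableAt (by simp)).hasFDerivAt
  have hNs : IsSymmSndFDerivAt ℝ N s := hN.isSymmSndFDerivAt (by simp; exact WithTop.coe_le_coe.2 (le_top (a := (2 : ℕ∞))))
  have hfs : IsSymmSndFDerivAt ℝ f s := (h.contDiffAt hs).isSymmSndFDerivAt (by simp; exact WithTop.coe_le_coe.2 (le_top (a := (2 : ℕ∞))))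
  have key : ∀ {Z : D → D}, HasFDerivAt Z (fderiv ℝ Z s) s →
      HasFDerivAt (fun s ↦ cov Γ f N s (Z s)) _ s := fun hZ ↦
    (hN2.clm_apply hZ).add ((hΓ.clm_apply (hf2.clm_apply hZ)).clm_apply hN1)
  have e1 := (key hX1).fderiv
  have e2 := (key hY1).fderiv
  simp only [cov] at e1 e2 ⊢
  rw [e1, e2]
  simp [curvature, lieBracket_eq, hNs.eq (X s) (Y s), hfs.eq (X s) (Y s)]
  abel

/-- The Ricci equation. -/
theorem metric_normalCurvature [FiniteDimensional ℝ D] (h : IsImmersion G Γ f U W) (hs : s ∈ U) {N : D → E} {X Y : D → D}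
    (hN : ContDiffAt ℝ ∞ N s) (hX : ContDiffAt ℝ ∞ X s) (hY : ContDiffAt ℝ ∞ Y s) {m : E}
    (hm : ∀ u, G (f s) m (fderiv ℝ f s u) = 0) :
    G (f s) (normalCurvature G Γ f X Y N s) m
      = G (f s) (curvature Γ (f s) (fderiv ℝ f s (X s)) (fderiv ℝ f s (Y s)) (N s)) m
        - G (f s) (hessian Γ f s (X s) (tangentPart G f s (cov Γ f N s (Y s)))) m
        + G (f s) (hessian Γ f s (Y s) (tangentPart G f s (cov Γ f N s (X s)))) m := by
  have hm' : ∀ u, G (f s) (fderiv ℝ f s u) m = 0 := fun u ↦ by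
    rw [h.metric_symm _ (h.mapsTo hs), hm]
  -- The inner derivative `D_Z N` is `∇_Z N` minus a tangential field. By `cov_fderiv`,
  -- differentiating that tangential field contributes only a Hessian term when paired with the
  -- normal vector `m`.
  have key : ∀ {Z : D → D} (u : D), ContDiffAt ℝ ∞ Z s →
      G (f s) (cov Γ f (normalCov G Γ f Z N) s u) m
        = G (f s) (cov Γ f (fun s ↦ cov Γ f N s (Z s)) s u) m
          - G (f s) (hessian Γ f s u (tangentPart G f s (cov Γ f N s (Z s)))) m := by
    intro Z u hZ
    have h1 := h.contDiffAt_cov hs hN hZ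
    have h2 := h.contDiffAt_tangentPart hs h1
    have h3 : normalCov G Γ f Z N = fun s ↦ cov Γ f N s (Z s)
      - fderiv ℝ f s (tangentPart G f s (cov Γ f N s (Z s))) := rfl
    rw [h3, cov_sub (h1.differentiableAt (by simp))
      (((h.contDiffAt_fderiv hs).clm_apply h2).differentiableAt (by simp)),
      h.cov_fderiv hs (h2.differentiableAt (by simp))]
    simp [hm']
  rw [← h.cov_cov_sub hs hN hX hY]
  simp only [normalCurvature]
  rw [normalCov.eq_def _ _ _ X, normalCov.eq_def _ _ _ Y, normalCov]
  simp only [map_sub, sub_apply, h.metric_normalPart hs _ hm, key _ hX, key _ hY]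
  ring

end IsImmersion

end Calculus

end LocalSurface

namespace LocalSurface

/-! ### Umbilical directions: linear algebra on the tangent and normal planes. -/

section Umbilic

variable {D E : Type*} [NormedAddCommGroup D] [NormedSpace ℝ D]
  [NormedAddCommGroup E] [NormedSpace ℝ E]

/-- The vector `n` is normal to the immersed surface `f` at `s`. -/
def IsNormalAt (G : E → E →L[ℝ] E →L[ℝ] ℝ) (f : D → E) (s : D) (n : E) : Prop :=
  ∀ u, G (f s) n (fderiv ℝ f s u) = 0

/-- The second fundamental form in the direction `n` is a multiple of the first one. -/
def IsUmbilicAt (G : E → E →L[ℝ] E →L[ℝ] ℝ) (Γ : E → E →L[ℝ] E →L[ℝ] E) (f : D → E)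
    (s : D) (n : E) : Prop :=
  ∃ κ : ℝ, ∀ u v, G (f s) n (hessian Γ f s u v) = κ * G (f s) (fderiv ℝ f s u) (fderiv ℝ f s v)

/-- The curvature in tangential directions preserves the splitting into tangential and normal
parts. -/
def CurvaturePreservesSplitting (G : E → E →L[ℝ] E →L[ℝ] ℝ) (Γ : E → E →L[ℝ] E →L[ℝ] E) (z : E) :
    Prop :=
  ∀ a b c m, G z a c = 0 → G z b c = 0 → G z a m = 0 → G z b m = 0 → G z (curvature Γ z a b c) m = 0

/-- A combination of values of the Hessian which is orthogonal to umbilic normal directions. -/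
def shear (G : E → E →L[ℝ] E →L[ℝ] ℝ) (Γ : E → E →L[ℝ] E →L[ℝ] E) (f : D → E) (b : Fin 2 → D)
    (i : Fin 2) (s : D) : E :=
  G (f s) (fderiv ℝ f s (b 0)) (fderiv ℝ f s (b 0)) • hessian Γ f s (b i) (b 1)
    - G (f s) (fderiv ℝ f s (b i)) (fderiv ℝ f s (b 1)) • hessian Γ f s (b 0) (b 0)

theorem hessian_add_left (Γ : E → E →L[ℝ] E →L[ℝ] E) (f : D → E) (s u u' v : D) :
    hessian Γ f s (u + u') v = hessian Γ f s u v + hessian Γ f s u' v := by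
  simp [hessian]; abel

theorem hessian_smul_left (Γ : E → E →L[ℝ] E →L[ℝ] E) (f : D → E) (s : D) (c : ℝ) (u v : D) :
    hessian Γ f s (c • u) v = c • hessian Γ f s u v := by
  simp [hessian]

theorem hessian_add_right (Γ : E → E →L[ℝ] E →L[ℝ] E) (f : D → E) (s u v v' : D) :
    hessian Γ f s u (v + v') = hessian Γ f s u v + hessian Γ f s u v' := by
  simp [hessian]; abel

theorem hessian_smul_right (Γ : E → E →L[ℝ] E →L[ℝ] E) (f : D → E) (s : D) (c : ℝ) (u v : D) :
    hessian Γ f s u (c • v) = c • hessian Γ f s u v := by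
  simp [hessian]

namespace IsImmersion

variable {G : E → E →L[ℝ] E →L[ℝ] ℝ} {Γ : E → E →L[ℝ] E →L[ℝ] E} {f : D → E}
  {U : Set D} {W : Set E} {s : D}

theorem contDiffAt_shear (h : IsImmersion G Γ f U W) (hs : s ∈ U) (b : Fin 2 → D) (i : Fin 2) :
    ContDiffAt ℝ ∞ (shear G Γ f b i) s := by
  have hG := h.contDiffAt_metric_comp hs
  have hf (u : D) : ContDiffAt ℝ ∞ (fun s ↦ fderiv ℝ f s u) s :=
    (h.contDiffAt_fderiv hs).clm_apply contDiffAt_const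
  exact (((hG.clm_apply (hf _)).clm_apply (hf _)).smul (h.contDiffAt_hessian hs _ _)).sub
    (((hG.clm_apply (hf _)).clm_apply (hf _)).smul (h.contDiffAt_hessian hs _ _))

/-- Evaluating on `(b 0, b 0)`, where the first form is positive, forces the factor `κ = h_n(b 0, b
0) / ⟨b 0, b 0⟩`. The two remaining independent entries must agree with this `κ`; cleared of
denominators, these are the two shear conditions. The trace-free part is thus encoded by two smooth
linear functionals of `n`, without choosing an orthonormal frame. -/
theorem isUmbilicAt_iff (h : IsImmersion G Γ f U W) (hs : s ∈ U) (b : Module.Basis (Fin 2) ℝ D)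
    (n : E) : IsUmbilicAt G Γ f s n ↔ ∀ i, G (f s) n (shear G Γ f b i s) = 0 := by
  have hpos := h.pos s hs (b 0) (b.ne_zero 0)
  constructor
  · rintro ⟨κ, hκ⟩ i
    simp only [shear, map_sub, map_smul, hκ, smul_eq_mul]
    ring
  · intro hi
    have h0 := hi 0
    have h1 := hi 1
    simp only [shear, map_sub, map_smul, smul_eq_mul] at h0 h1
    refine ⟨G (f s) n (hessian Γ f s (b 0) (b 0)) /
      G (f s) (fderiv ℝ f s (b 0)) (fderiv ℝ f s (b 0)), fun u v ↦ ?_⟩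
    rw [← b.sum_repr u, ← b.sum_repr v, Fin.sum_univ_two, Fin.sum_univ_two]
    simp only [hessian_add_left, hessian_add_right, hessian_smul_left, hessian_smul_right,
      h.hessian_symm hs (b 1) (b 0), map_add, map_smul, add_apply, smul_apply, smul_eq_mul,
      h.metric_symm _ (h.mapsTo hs) (fderiv ℝ f s (b 1)) (fderiv ℝ f s (b 0))]
    field_simp
    -- The shear with index 0 governs the off-diagonal entry, the one with index 1 the entry at `(b
    -- 1, b 1)`.
    linear_combination (b.repr u 0 * b.repr v 1 + b.repr u 1 * b.repr v 0) * h0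
      + b.repr u 1 * b.repr v 1 * h1

/-- By the Weingarten equation the operator is minus the dual of the second form, so the two factors
are negatives of each other. -/
theorem isUmbilicAt_iff_tangentPart [FiniteDimensional ℝ D] (h : IsImmersion G Γ f U W)
    (hs : s ∈ U) {N : D → E} (hN : ContDiffAt ℝ ∞ N s) (hn : ∀ᶠ y in 𝓝 s, IsNormalAt G f y (N y)) :
    IsUmbilicAt G Γ f s (N s) ↔ ∃ c : ℝ, ∀ u, tangentPart G f s (cov Γ f N s u) = c • u := by
  have hw := h.metric_cov_fderiv hs hN hn
  constructor
  · rintro ⟨κ, hκ⟩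
    refine ⟨-κ, fun u ↦ h.tangentPart_eq_of_forall hs fun v ↦ ?_⟩
    rw [hw, hκ]
    simp
  · rintro ⟨c, hc⟩
    refine ⟨-c, fun u v ↦ ?_⟩
    have h1 := h.firstForm_tangentPart hs (cov Γ f N s u) v
    rw [hc, hw] at h1
    simp at h1
    linarith

/-- The submodule of normal vectors has codimension `dim D`. -/
theorem finrank_ker_add [FiniteDimensional ℝ D] [FiniteDimensional ℝ E]
    (h : IsImmersion G Γ f U W) (hs : s ∈ U) :
    ∃ K : Submodule ℝ E, (∀ n, n ∈ K ↔ IsNormalAt G f s n) ∧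
      Module.finrank ℝ D + Module.finrank ℝ K = Module.finrank ℝ E := by
  let l : E →ₗ[ℝ] D →L[ℝ] ℝ :=
    ((ContinuousLinearMap.compL ℝ D E ℝ).flip (fderiv ℝ f s)).comp (G (f s))
  have hl : ∀ n u, l n u = G (f s) n (fderiv ℝ f s u) := fun n u ↦ rfl
  have hsurj : Function.Surjective l := by
    intro φ
    obtain ⟨t, ht⟩ := (h.firstForm_bijective hs).2 φ
    refine ⟨fderiv ℝ f s t, ?_⟩
    ext u
    rw [hl, ← ht]
    simp [firstForm]
  have hrank : Module.finrank ℝ (D →L[ℝ] ℝ) = Module.finrank ℝ D := by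
    rw [← LinearEquiv.finrank_eq (LinearMap.toContinuousLinearMap (𝕜 := ℝ) (E := D) (F' := ℝ)),
      Module.finrank_linearMap, Module.finrank_self, mul_one]
  refine ⟨LinearMap.ker l, fun n ↦ ?_, ?_⟩
  · rw [LinearMap.mem_ker]
    exact ⟨fun hn u ↦ by rw [← hl, hn]; rfl, fun hn ↦ by ext u; exact hn u⟩
  · rw [← hrank, ← finrank_top ℝ (D →L[ℝ] ℝ), ← LinearMap.range_eq_top.2 hsurj]
    exact l.finrank_range_add_finrank_ker

/-- The normal space has dimension `4 - 2 = 2`, so one vector cannot span it. Taking `n = 0`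
produces a nonzero normal vector. -/
theorem exists_independent_normal [FiniteDimensional ℝ D] [FiniteDimensional ℝ E]
    (h : IsImmersion G Γ f U W) (hs : s ∈ U) (hD : Module.finrank ℝ D = 2)
    (hE : Module.finrank ℝ E = 4) (n : E) :
    ∃ n', IsNormalAt G f s n' ∧ ∀ a : ℝ, n' ≠ a • n := by
  obtain ⟨K, hK, hrank⟩ := h.finrank_ker_add hs
  by_contra! hcon
  have hle : K ≤ Submodule.span ℝ {n} := fun n' hn' ↦ by
    obtain ⟨a, rfl⟩ := hcon n' ((hK _).1 hn')
    exact Submodule.smul_mem _ _ (Submodule.mem_span_singleton_self n)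
  have h1 := (Submodule.finrank_mono hle).trans (finrank_span_le_card (R := ℝ) {n})
  rw [Set.toFinset_singleton, Finset.card_singleton] at h1
  omega

/-- In the normal plane, `n` and `n₁` either form a basis, which then expresses `n₂`, or are
dependent. -/
theorem exists_relation [FiniteDimensional ℝ D] [FiniteDimensional ℝ E]
    (h : IsImmersion G Γ f U W) (hs : s ∈ U) (hD : Module.finrank ℝ D = 2)
    (hE : Module.finrank ℝ E = 4) {n n₁ n₂ : E} (hn : IsNormalAt G f s n) (hne : n ≠ 0)
    (hn₁ : IsNormalAt G f s n₁) (hn₂ : IsNormalAt G f s n₂) :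
    (∃ a b : ℝ, n₂ = a • n + b • n₁) ∨ ∃ a : ℝ, n₁ = a • n := by
  obtain ⟨K, hK, hrank⟩ := h.finrank_ker_add hs
  by_contra! hcon
  have hli : LinearIndependent ℝ ![(⟨n, (hK _).2 hn⟩ : K), ⟨n₁, (hK _).2 hn₁⟩] := by
    rw [LinearIndependent.pair_iff' (by simpa [Subtype.ext_iff] using hne)]
    intro a ha
    exact hcon.2 a (congrArg Subtype.val ha).symm
  have hspan := hli.span_eq_top_of_card_eq_finrank (by simp; omega)
  have hmem : (⟨n₂, (hK _).2 hn₂⟩ : K) ∈ Submodule.span ℝ (Set.range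
      ![(⟨n, (hK _).2 hn⟩ : K), ⟨n₁, (hK _).2 hn₁⟩]) := hspan ▸ Submodule.mem_top
  rw [Matrix.range_cons, Matrix.range_cons, Matrix.range_empty, Set.union_empty,
    Set.singleton_union, Submodule.mem_span_pair] at hmem
  obtain ⟨a, b, hab⟩ := hmem
  exact hcon.1 a b (congrArg Subtype.val hab).symm

/-- If some normal direction is umbilic, then the normal curvature vanishes. -/
theorem normalCurvature_eq_zero [FiniteDimensional ℝ D] [FiniteDimensional ℝ E]
    (h : IsImmersion G Γ f U W) (hs : s ∈ U) (hD : Module.finrank ℝ D = 2)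
    (hE : Module.finrank ℝ E = 4) (hnd : ∀ a, (∀ b, G (f s) a b = 0) → a = 0)
    (hR : CurvaturePreservesSplitting G Γ (f s)) {n : E} (hn : IsNormalAt G f s n) (hne : n ≠ 0)
    (hu : IsUmbilicAt G Γ f s n) {N : D → E} {X Y : D → D}
    (hN : ContDiffAt ℝ ∞ N s) (hNn : ∀ᶠ y in 𝓝 s, IsNormalAt G f y (N y))
    (hX : ContDiffAt ℝ ∞ X s) (hY : ContDiffAt ℝ ∞ Y s) : normalCurvature G Γ f X Y N s = 0 := by
  have hsymm := h.metric_symm _ (h.mapsTo hs)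
  have hw := h.metric_cov_fderiv hs hN hNn
  have hA : ∀ u v, G (f s) (fderiv ℝ f s (tangentPart G f s (cov Γ f N s u))) (fderiv ℝ f s v)
      = - G (f s) (N s) (hessian Γ f s u v) := fun u v ↦ (h.firstForm_tangentPart hs _ v).trans
        (hw u v)
  have hA' : ∀ u v, G (f s) (fderiv ℝ f s v) (fderiv ℝ f s (tangentPart G f s (cov Γ f N s u)))
      = - G (f s) (N s) (hessian Γ f s u v) := fun u v ↦ by rw [hsymm, hA]
  obtain ⟨κ, hκ⟩ := hu
  have key : ∀ m, IsNormalAt G f s m → G (f s) (normalCurvature G Γ f X Y N s) m = 0 := by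
    intro m hm
    rw [h.metric_normalCurvature hs hN hX hY hm, hR, hsymm _ m, hsymm _ m]
    · rcases h.exists_relation hs hD hE hn hne hNn.self_of_nhds hm with ⟨a, b, rfl⟩ | ⟨a, ha⟩
      · simp only [map_add, map_smul, add_apply, smul_apply, smul_eq_mul, hκ, hA']
        have e1 := hA (X s) (tangentPart G f s (cov Γ f N s (Y s)))
        have e2 := hA (Y s) (tangentPart G f s (cov Γ f N s (X s)))
        rw [hA'] at e1
        rw [hA'] at e2
        rw [h.hessian_symm hs (X s) (Y s)]
        linear_combination (-b) * e1
      · have hsc : ∀ u, tangentPart G f s (cov Γ f N s u) = (- (a * κ)) • u := fun u ↦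
          h.tangentPart_eq_of_forall hs fun v ↦ by
            rw [hw, ha]; simp only [map_smul, smul_apply, smul_eq_mul, hκ]; ring
        rw [hsc, hsc, hessian_smul_right, hessian_smul_right, h.hessian_symm hs (X s) (Y s)]
        ring
    · rw [hsymm]; exact hNn.self_of_nhds _
    · rw [hsymm]; exact hNn.self_of_nhds _
    · rw [hsymm]; exact hm _
    · rw [hsymm]; exact hm _
  have hnormal : IsNormalAt G f s (normalCurvature G Γ f X Y N s) := fun u ↦ by
    simp only [normalCurvature, normalCov, map_sub, sub_apply, h.normalPart_orthogonal hs]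
    simp
  -- By nondegeneracy it suffices to pair with every `v`. The normal part of `v` is covered by
  -- `key`, the tangential part by normality of the curvature vector.
  refine hnd _ fun v ↦ ?_
  have hv : v = normalPart G f s v + fderiv ℝ f s (tangentPart G f s v) := by simp [normalPart]
  rw [hv, map_add, key _ (h.normalPart_orthogonal hs v), hnormal, add_zero]

/-- If the normal curvature vanishes, then the trace-free second fundamental forms in the normal
directions are proportional. -/
theorem shear_mul_shear [FiniteDimensional ℝ D]
    (h : IsImmersion G Γ f U W) (hs : s ∈ U) (b : Module.Basis (Fin 2) ℝ D)
    (hR : CurvaturePreservesSplitting G Γ (f s)) {N : D → E}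
    (hN : ContDiffAt ℝ ∞ N s) (hNn : ∀ᶠ y in 𝓝 s, IsNormalAt G f y (N y))
    {X Y : D → D} (hX : ContDiffAt ℝ ∞ X s) (hY : ContDiffAt ℝ ∞ Y s) (hXb : X s = b 0)
    (hYb : Y s = b 1) (h0 : normalCurvature G Γ f X Y N s = 0) {m : E} (hm : IsNormalAt G f s m) :
    G (f s) (N s) (shear G Γ f b 0 s) * G (f s) m (shear G Γ f b 1 s)
      = G (f s) m (shear G Γ f b 0 s) * G (f s) (N s) (shear G Γ f b 1 s) := by
  have hsymm := h.metric_symm _ (h.mapsTo hs)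
  have hw := h.metric_cov_fderiv hs hN hNn
  have hA : ∀ u v, G (f s) (fderiv ℝ f s (tangentPart G f s (cov Γ f N s u))) (fderiv ℝ f s v)
      = - G (f s) (N s) (hessian Γ f s u v) := fun u v ↦ (h.firstForm_tangentPart hs _ v).trans
        (hw u v)
  have h1 := h.metric_normalCurvature hs hN hX hY hm
  rw [h0, hXb, hYb, hR _ _ _ _ ((hsymm _ _).trans (hNn.self_of_nhds _))
    ((hsymm _ _).trans (hNn.self_of_nhds _)) ((hsymm _ _).trans (hm _)) ((hsymm _ _).trans (hm _)),
    map_zero, zero_apply, hsymm _ m, hsymm _ m] at h1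
  have e00 := hA (b 0) (b 0)
  have e01 := hA (b 0) (b 1)
  have e10 := hA (b 1) (b 0)
  have e11 := hA (b 1) (b 1)
  set t₀ := tangentPart G f s (cov Γ f N s (b 0))
  set t₁ := tangentPart G f s (cov Γ f N s (b 1))
  rw [← b.sum_repr t₀, Fin.sum_univ_two] at e00 e01 h1
  rw [← b.sum_repr t₁, Fin.sum_univ_two] at e10 e11 h1
  simp only [hessian_add_right, hessian_smul_right, h.hessian_symm hs (b 1) (b 0),
    map_add, map_smul, add_apply, smul_apply, smul_eq_mul,
    hsymm (fderiv ℝ f s (b 1)) (fderiv ℝ f s (b 0))] at h1 e00 e01 e10 e11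
  simp only [shear, map_sub, map_smul, smul_eq_mul]
  generalize b.repr t₀ 0 = p at *
  generalize b.repr t₀ 1 = q at *
  generalize b.repr t₁ 0 = r at *
  generalize b.repr t₁ 1 = t at *
  generalize G (f s) (fderiv ℝ f s (b 0)) (fderiv ℝ f s (b 0)) = H00 at *
  generalize G (f s) (fderiv ℝ f s (b 0)) (fderiv ℝ f s (b 1)) = H01 at *
  generalize G (f s) (fderiv ℝ f s (b 1)) (fderiv ℝ f s (b 1)) = H11 at *
  generalize G (f s) (N s) (hessian Γ f s (b 0) (b 0)) = N00 at *
  generalize G (f s) (N s) (hessian Γ f s (b 0) (b 1)) = N01 at *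
  generalize G (f s) (N s) (hessian Γ f s (b 1) (b 1)) = N11 at *
  generalize G (f s) m (hessian Γ f s (b 0) (b 0)) = M00 at *
  generalize G (f s) m (hessian Γ f s (b 0) (b 1)) = M01 at *
  generalize G (f s) m (hessian Γ f s (b 1) (b 1)) = M11 at *
  -- The numbers `p, q, r, t` are the matrix entries of `A_N` in the basis `b`. The second form of
  -- `N` is eliminated in their favour.
  obtain rfl : N00 = -(p * H00 + q * H01) := by linarith
  obtain rfl : N01 = -(p * H01 + q * H11) := by linarith
  obtain rfl : N11 = -(r * H01 + t * H11) := by linarith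
  -- Self-adjointness of `A_N`.
  have e10' : r * H00 + t * H01 = p * H01 + q * H11 := by linarith
  -- The proportionality defect of the two shear pairs is the commutator term times `H00` and the
  -- Gram determinant, modulo self-adjointness.
  linear_combination (H00 * (H00 * H11 - H01 ^ 2)) * h1
    + (H00 * H01 * M01 - H00 * H11 * M00) * e10'

/-- The vanishing of the normal curvature near a point which is not umbilic in all normal directions
gives a normal field in umbilic directions. -/
theorem exists_umbilic_field [FiniteDimensional ℝ D] [FiniteDimensional ℝ E]
    (h : IsImmersion G Γ f U W) (hs : s ∈ U) (b : Module.Basis (Fin 2) ℝ D)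
    (hE : Module.finrank ℝ E = 4) {n : E} (hn : IsNormalAt G f s n)
    (hu : ¬ IsUmbilicAt G Γ f s n) :
    ∃ M : D → E, (∀ y ∈ U, ContDiffAt ℝ ∞ M y ∧ IsNormalAt G f y (M y)) ∧ M s ≠ 0 ∧
      ∀ y ∈ U, (∀ n₁ n₂, IsNormalAt G f y n₁ → IsNormalAt G f y n₂ →
        G (f y) n₁ (shear G Γ f b 0 y) * G (f y) n₂ (shear G Γ f b 1 y)
          = G (f y) n₂ (shear G Γ f b 0 y) * G (f y) n₁ (shear G Γ f b 1 y)) →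
        IsUmbilicAt G Γ f y (M y) := by
  have hD : Module.finrank ℝ D = 2 := by simp [Module.finrank_eq_card_basis b]
  obtain ⟨n', hn', hind⟩ := h.exists_independent_normal hs hD hE n
  rw [h.isUmbilicAt_iff hs b] at hu
  push Not at hu
  obtain ⟨i, hi⟩ := hu
  have hP : ∀ v : E, ∀ y ∈ U, ContDiffAt ℝ ∞ (fun y ↦ normalPart G f y v) y := fun v y hy ↦
    h.contDiffAt_normalPart hy contDiffAt_const
  have hS : ∀ v : E, ∀ y ∈ U,
      ContDiffAt ℝ ∞ (fun y ↦ G (f y) (normalPart G f y v) (shear G Γ f b i y)) y := fun v y hy ↦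
    ((h.contDiffAt_metric_comp hy).clm_apply (hP v y hy)).clm_apply (h.contDiffAt_shear hy b i)
  -- With `S` the `i`-th shear functional, nonzero on `n` at `s`, the field `S(n') n - S(n) n'`,
  -- built from normal projections of the constants `n` and `n'`, lies in the kernel of `S`.
  refine ⟨fun y ↦ G (f y) (normalPart G f y n') (shear G Γ f b i y) • normalPart G f y n
    - G (f y) (normalPart G f y n) (shear G Γ f b i y) • normalPart G f y n', fun y hy ↦
      ⟨((hS n' y hy).smul (hP n y hy)).sub ((hS n y hy).smul (hP n' y hy)), fun u ↦ ?_⟩, ?_, ?_⟩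
  · simp [h.normalPart_orthogonal hy]
  · beta_reduce
    rw [h.normalPart_eq_self hs hn, h.normalPart_eq_self hs hn', sub_ne_zero]
    -- Vanishing at `s` would make `n'` a multiple of `n`, because `S(n) ≠ 0` there.
    intro heq
    refine hind ((G (f s) n (shear G Γ f b i s))⁻¹ * G (f s) n' (shear G Γ f b i s)) ?_
    rw [mul_smul, heq, smul_smul, inv_mul_cancel₀ hi, one_smul]
  · intro y hy hprop
    rw [h.isUmbilicAt_iff hy b]
    have hp := hprop _ _ (h.normalPart_orthogonal hy n) (h.normalPart_orthogonal hy n')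
    intro j
    simp only [map_sub, map_smul, sub_apply, smul_apply, smul_eq_mul]
    -- For `j = i` the two terms cancel identically. For `j ≠ i` the cancellation is the assumed
    -- proportionality.
    fin_cases i <;> fin_cases j <;> simp only [Fin.zero_eta, Fin.mk_one] <;> linarith

/-- If some normal direction is umbilic, then the trace-free second fundamental forms in the normal
directions are proportional. -/
theorem shear_mul_shear_of_isUmbilicAt [FiniteDimensional ℝ D] [FiniteDimensional ℝ E]
    (h : IsImmersion G Γ f U W) (hs : s ∈ U) (b : Module.Basis (Fin 2) ℝ D) (hE : Module.finrank ℝ E = 4) {n : E}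
    (hn : IsNormalAt G f s n) (hne : n ≠ 0) (hu : IsUmbilicAt G Γ f s n) {n₁ n₂ : E}
    (hn₁ : IsNormalAt G f s n₁) (hn₂ : IsNormalAt G f s n₂) :
    G (f s) n₁ (shear G Γ f b 0 s) * G (f s) n₂ (shear G Γ f b 1 s)
      = G (f s) n₂ (shear G Γ f b 0 s) * G (f s) n₁ (shear G Γ f b 1 s) := by
  have hD : Module.finrank ℝ D = 2 := by simp [Module.finrank_eq_card_basis b]
  have h0 := (h.isUmbilicAt_iff hs b n).1 hu
  rcases h.exists_relation hs hD hE hn hne hn₁ hn₂ with ⟨a, c, rfl⟩ | ⟨a, rfl⟩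
  · simp only [map_add, map_smul, add_apply, smul_apply, smul_eq_mul, h0]
    ring
  · simp only [map_smul, smul_apply, smul_eq_mul, h0]
    ring

end IsImmersion

end Umbilic

end LocalSurface

namespace LocalSurface

/-! ### The Levi-Civita connection of a coordinate metric and its conformally flat case. -/

section LeviCivita

variable {E : Type*} [NormedAddCommGroup E] [NormedSpace ℝ E]

/-- The Christoffel symbols of the first kind. -/
def koszul (G : E → E →L[ℝ] E →L[ℝ] ℝ) (z : E) : E →L[ℝ] E →L[ℝ] E →L[ℝ] ℝ :=
  (1 / 2 : ℝ) • (fderiv ℝ G z + (fderiv ℝ G z).flip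
    - ((ContinuousLinearMap.flipₗᵢ ℝ E E ℝ : (E →L[ℝ] E →L[ℝ] ℝ) →L[ℝ] E →L[ℝ] E →L[ℝ] ℝ)).comp
      (fderiv ℝ G z).flip)

/-- The Christoffel symbols of the second kind. -/
def leviCivita (G : E → E →L[ℝ] E →L[ℝ] ℝ) (z : E) : E →L[ℝ] E →L[ℝ] E :=
  (ContinuousLinearMap.compL ℝ E (E →L[ℝ] ℝ) E (G z).inverse).comp (koszul G z)

theorem koszul_apply (G : E → E →L[ℝ] E →L[ℝ] ℝ) (z a b c : E) :
    koszul G z a b c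
      = (1 / 2 : ℝ) * (fderiv ℝ G z a b c + fderiv ℝ G z b a c - fderiv ℝ G z c a b) := by
  simp [koszul]

theorem isInvertible_of_nondegenerate [FiniteDimensional ℝ E] {B : E →L[ℝ] E →L[ℝ] ℝ}
    (hB : ∀ a, (∀ b, B a b = 0) → a = 0) : B.IsInvertible := by
  have hinj : Function.Injective (B : E →ₗ[ℝ] E →L[ℝ] ℝ) := by
    rw [injective_iff_map_eq_zero]
    intro u hu
    refine hB u fun b ↦ ?_
    have : B u = 0 := hu
    rw [this]; rfl
  have hrank : Module.finrank ℝ E = Module.finrank ℝ (E →L[ℝ] ℝ) := by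
    rw [← LinearEquiv.finrank_eq (LinearMap.toContinuousLinearMap (𝕜 := ℝ) (E := E) (F' := ℝ)),
      Module.finrank_linearMap, Module.finrank_self, mul_one]
  have hb : Function.Bijective (B : E →ₗ[ℝ] E →L[ℝ] ℝ) :=
    ⟨hinj, (LinearMap.injective_iff_surjective_of_finrank_eq_finrank hrank).1 hinj⟩
  exact ⟨(LinearEquiv.ofBijective _ hb).toContinuousLinearEquiv, by ext u v; rfl⟩

/-- `G` is a smooth metric on the open set `W`. -/
structure IsMetricOn (G : E → E →L[ℝ] E →L[ℝ] ℝ) (W : Set E) : Prop where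
  isOpen : IsOpen W
  contDiffOn : ContDiffOn ℝ ∞ G W
  symm : ∀ z ∈ W, ∀ a b, G z a b = G z b a
  nondegenerate : ∀ z ∈ W, ∀ a, (∀ b, G z a b = 0) → a = 0

namespace IsMetricOn

variable {G : E → E →L[ℝ] E →L[ℝ] ℝ} {W : Set E} {z : E}

theorem contDiffAt (h : IsMetricOn G W) (hz : z ∈ W) : ContDiffAt ℝ ∞ G z :=
  h.contDiffOn.contDiffAt (h.isOpen.mem_nhds hz)

theorem hasFDerivAt (h : IsMetricOn G W) (hz : z ∈ W) : HasFDerivAt G (fderiv ℝ G z) z :=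
  ((h.contDiffAt hz).differentiableAt (by simp)).hasFDerivAt

theorem fderiv_symm (h : IsMetricOn G W) (hz : z ∈ W) (a b c : E) :
    fderiv ℝ G z a b c = fderiv ℝ G z a c b := by
  have key : ∀ b c, HasFDerivAt (fun y ↦ G y b c)
      (((ContinuousLinearMap.flip (fderiv ℝ G z) b).flip c)) z := fun b c ↦ by
    refine (((h.hasFDerivAt hz).clm_apply (hasFDerivAt_const b z)).clm_apply
      (hasFDerivAt_const c z)).congr_fderiv ?_
    ext; simp
  have h2 : HasFDerivAt (fun y ↦ G y b c) (((fderiv ℝ G z).flip c).flip b) z :=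
    (key c b).congr_of_eventuallyEq
      (Filter.eventually_of_mem (h.isOpen.mem_nhds hz) fun y hy ↦ h.symm y hy b c)
  exact congrArg (fun l : E →L[ℝ] ℝ ↦ l a) ((key b c).unique h2)

theorem eq_of_forall (h : IsMetricOn G W) (hz : z ∈ W) {a b : E} (hab : ∀ c, G z a c = G z b c) :
    a = b :=
  sub_eq_zero.1 (h.nondegenerate z hz _ fun c ↦ by simp [hab])

variable [FiniteDimensional ℝ E]

theorem metric_leviCivita (h : IsMetricOn G W) (hz : z ∈ W) (a b c : E) :
    G z (leviCivita G z a b) c = koszul G z a b c := by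
  obtain ⟨L, hL⟩ := isInvertible_of_nondegenerate (h.nondegenerate z hz)
  have : G z (leviCivita G z a b) = koszul G z a b := by
    change G z ((G z).inverse (koszul G z a b)) = _
    rw [← hL, ContinuousLinearMap.inverse_equiv]
    simp
  rw [this]

theorem leviCivita_eq (h : IsMetricOn G W) (hz : z ∈ W) {a b w : E}
    (hw : ∀ c, G z w c = koszul G z a b c) : leviCivita G z a b = w :=
  h.eq_of_forall hz fun c ↦ by rw [h.metric_leviCivita hz, hw]

theorem leviCivita_symm (h : IsMetricOn G W) (hz : z ∈ W) (a b : E) :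
    leviCivita G z a b = leviCivita G z b a :=
  h.leviCivita_eq hz fun c ↦ by
    rw [h.metric_leviCivita hz, koszul_apply, koszul_apply, h.fderiv_symm hz c a b]; ring

theorem fderiv_metric (h : IsMetricOn G W) (hz : z ∈ W) (a b c : E) :
    fderiv ℝ G z a b c = G z (leviCivita G z a b) c + G z b (leviCivita G z a c) := by
  rw [h.symm z hz b, h.metric_leviCivita hz, h.metric_leviCivita hz, koszul_apply, koszul_apply,
    h.fderiv_symm hz a c b, h.fderiv_symm hz b a c, h.fderiv_symm hz c a b]
  ring

theorem contDiffOn_leviCivita (h : IsMetricOn G W) : ContDiffOn ℝ ∞ (leviCivita G) W := by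
  intro z hz
  refine ContDiffAt.contDiffWithinAt ?_
  obtain ⟨L, hL⟩ := isInvertible_of_nondegenerate (h.nondegenerate z hz)
  have hI : ContDiffAt ℝ ∞ (fun z ↦ (G z).inverse) z := by
    have h1 : ContDiffAt ℝ ∞ ContinuousLinearMap.inverse (G z) := by
      rw [← hL]; exact contDiffAt_map_inverse L
    exact h1.comp z (h.contDiffAt hz)
  have hD : ContDiffOn ℝ ∞ (fderiv ℝ G) W := fun z hz ↦
    ((h.contDiffAt hz).fderiv_right (m := ∞) (by simp)).contDiffWithinAt
  have hK : ContDiffOn ℝ ∞ (koszul G) W := by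
    refine contDiffOn_clm_apply.2 fun a ↦ contDiffOn_clm_apply.2 fun b ↦
      contDiffOn_clm_apply.2 fun c ↦ ?_
    simp only [koszul_apply]
    have hc (a b c : E) : ContDiffOn ℝ ∞ (fun z ↦ fderiv ℝ G z a b c) W :=
      ((hD.clm_apply contDiffOn_const).clm_apply contDiffOn_const).clm_apply contDiffOn_const
    exact contDiffOn_const.mul (((hc _ _ _).add (hc _ _ _)).sub (hc _ _ _))
  exact (ContDiffAt.clm_apply contDiffAt_const hI).clm_comp
    (hK.contDiffAt (h.isOpen.mem_nhds hz))

/-- The transformation law of the Christoffel symbols. -/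
theorem leviCivita_transform {G' : E → E →L[ℝ] E →L[ℝ] ℝ} {W' : Set E} {τ : E → E}
    (h : IsMetricOn G W) (h' : IsMetricOn G' W') (hz : z ∈ W) (hz' : τ z ∈ W')
    (hτ : ContDiffAt ℝ ∞ τ z) (hsurj : Function.Surjective (fderiv ℝ τ z))
    (hG : ∀ᶠ y in 𝓝 z, ∀ a b, G y a b = G' (τ y) (fderiv ℝ τ y a) (fderiv ℝ τ y b)) (a b : E) :
    fderiv ℝ τ z (leviCivita G z a b)
      = fderiv ℝ (fderiv ℝ τ) z a b
        + leviCivita G' (τ z) (fderiv ℝ τ z a) (fderiv ℝ τ z b) := by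
  have hτ2 : HasFDerivAt (fderiv ℝ τ) (fderiv ℝ (fderiv ℝ τ) z) z :=
    ((hτ.fderiv_right (m := ∞) (by simp)).differentiableAt (by simp)).hasFDerivAt
  have hG' := (h'.hasFDerivAt hz').comp z (hτ.differentiableAt (by simp)).hasFDerivAt
  have hsym : IsSymmSndFDerivAt ℝ τ z :=
    hτ.isSymmSndFDerivAt (by simp; exact WithTop.coe_le_coe.2 (le_top (a := (2 : ℕ∞))))
  have key : ∀ a b c, fderiv ℝ G z a b c
      = fderiv ℝ G' (τ z) (fderiv ℝ τ z a) (fderiv ℝ τ z b) (fderiv ℝ τ z c)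
        + G' (τ z) (fderiv ℝ (fderiv ℝ τ) z a b) (fderiv ℝ τ z c)
        + G' (τ z) (fderiv ℝ τ z b) (fderiv ℝ (fderiv ℝ τ) z a c) := by
    intro a b c
    have h1 := (((h.hasFDerivAt hz).clm_apply (hasFDerivAt_const b z)).clm_apply
      (hasFDerivAt_const c z))
    have h2 := ((hG'.clm_apply (hτ2.clm_apply (hasFDerivAt_const b z))).clm_apply
      (hτ2.clm_apply (hasFDerivAt_const c z)))
    have h3 := h2.congr_of_eventuallyEq (f₁ := fun y ↦ G y b c) (hG.mono fun y hy ↦ hy b c)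
    have h4 := congrArg (fun l : E →L[ℝ] ℝ ↦ l a) (h1.unique h3)
    simp at h4
    linarith
  refine h'.eq_of_forall hz' fun c' ↦ ?_
  obtain ⟨c, rfl⟩ := hsurj c'
  rw [← hG.self_of_nhds, h.metric_leviCivita hz, koszul_apply, map_add, add_apply,
    h'.metric_leviCivita hz', koszul_apply, key, key, key, hsym.eq b a, hsym.eq c a, hsym.eq c b,
    h'.symm _ hz' (fderiv ℝ τ z b), h'.symm _ hz' (fderiv ℝ τ z a)]
  ring

/-- The curvature of a conformally flat metric preserves orthogonal splittings. -/
theorem curvaturePreservesSplitting_of_conformal (h : IsMetricOn G W) (hz : z ∈ W)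
    {η : E →L[ℝ] E →L[ℝ] ℝ} {Ω : E → ℝ} (hΩ : ContDiffOn ℝ ∞ Ω W) (hpos : ∀ y ∈ W, 0 < Ω y)
    (hG : ∀ y ∈ W, G y = Ω y • η) : CurvaturePreservesSplitting G (leviCivita G) z := by
  have hηs : ∀ a b, η a b = η b a := fun a b ↦ by
    have := h.symm z hz a b
    simpa [hG z hz, (hpos z hz).ne'] using this
  have hηn : ∀ a, (∀ b, η a b = 0) → a = 0 := fun a ha ↦
    h.nondegenerate z hz a fun b ↦ by simp [hG z hz, ha]
  obtain ⟨L, hL⟩ := isInvertible_of_nondegenerate hηn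
  have hΩ' : ∀ y ∈ W, ContDiffAt ℝ ∞ Ω y := fun y hy ↦ hΩ.contDiffAt (h.isOpen.mem_nhds hy)
  -- The conformal factor is written as `Ω = e^{2l}`, so that `dΩ = 2 Ω dl`.
  set l : E → ℝ := fun y ↦ (1 / 2 : ℝ) * Real.log (Ω y) with hl
  have hlc : ∀ y ∈ W, ContDiffAt ℝ ∞ l y := fun y hy ↦
    contDiffAt_const.mul ((hΩ' y hy).log (hpos y hy).ne')
  have hld : ∀ y ∈ W, ∀ a, fderiv ℝ Ω y a = 2 * Ω y * fderiv ℝ l y a := by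
    intro y hy a
    have h1 := ((((hΩ' y hy).differentiableAt (by simp)).hasFDerivAt.log (hpos y hy).ne').const_mul
      (1 / 2 : ℝ)).fderiv
    rw [hl, h1]
    have := (hpos y hy).ne'
    simp
    field_simp
  have hDG : ∀ y ∈ W, ∀ a b c, fderiv ℝ G y a b c = 2 * Ω y * fderiv ℝ l y a * η b c := by
    intro y hy a b c
    have h1 := (((hΩ' y hy).differentiableAt (by simp)).hasFDerivAt.smul_const η)
    have h2 := h1.congr_of_eventuallyEq (f₁ := G)
      (Filter.eventually_of_mem (h.isOpen.mem_nhds hy) hG)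
    rw [h2.fderiv]
    simp [hld y hy]
  -- The gradient of `l` with respect to the constant form `η`.
  set r : E → E := fun y ↦ L.symm (fderiv ℝ l y) with hr
  have hηr : ∀ y c, η (r y) c = fderiv ℝ l y c := fun y c ↦ by
    rw [← hL]; simp [hr]
  have hΓ : ∀ y ∈ W, ∀ a b, leviCivita G y a b
      = fderiv ℝ l y a • b + fderiv ℝ l y b • a - η a b • r y := by
    intro y hy a b
    refine h.leviCivita_eq hy fun c ↦ ?_
    rw [koszul_apply, hDG y hy, hDG y hy, hDG y hy, hG y hy]
    simp [hηr]
    ring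
  have hΓd : HasFDerivAt (leviCivita G) (fderiv ℝ (leviCivita G) z) z :=
    ((h.contDiffOn_leviCivita.contDiffAt (h.isOpen.mem_nhds hz)).differentiableAt
      (by simp)).hasFDerivAt
  have hl2 : HasFDerivAt (fderiv ℝ l) (fderiv ℝ (fderiv ℝ l) z) z :=
    (((hlc z hz).fderiv_right (m := ∞) (by simp)).differentiableAt (by simp)).hasFDerivAt
  have hsym : IsSymmSndFDerivAt ℝ l z :=
    (hlc z hz).isSymmSndFDerivAt (by simp; exact WithTop.coe_le_coe.2 (le_top (a := (2 : ℕ∞))))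
  -- Since `η` is constant, `η b c = 0` removes the gradient term of the Christoffel symbols on all
  -- of `W`, so `r` never has to be differentiated.
  have hDΓ : ∀ a b c, η b c = 0 → fderiv ℝ (leviCivita G) z a b c
      = fderiv ℝ (fderiv ℝ l) z a b • c + fderiv ℝ (fderiv ℝ l) z a c • b := by
    intro a b c hbc
    have h1 := (hΓd.clm_apply (hasFDerivAt_const b z)).clm_apply (hasFDerivAt_const c z)
    have h2 := ((hl2.clm_apply (hasFDerivAt_const b z)).smul_const c).add
      ((hl2.clm_apply (hasFDerivAt_const c z)).smul_const b)
    have h3 := h2.congr_of_eventuallyEq (f₁ := fun y ↦ leviCivita G y b c)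
      (Filter.eventually_of_mem (h.isOpen.mem_nhds hz) fun y hy ↦ by simp [hΓ y hy, hbc])
    have h4 := congrArg (fun l : E →L[ℝ] E ↦ l a) (h1.unique h3)
    simpa using h4
  intro a b c m hac hbc ham hbm
  have hne := (hpos z hz).ne'
  simp only [hG z hz, smul_apply, smul_eq_mul, mul_eq_zero, hne, false_or] at hac hbc ham hbm ⊢
  -- After pairing with `m`, terms along `a` or `b` vanish. What remains are multiples of `η c m`
  -- and of `η a b`, all symmetric in `a, b`, and these cancel in the commutator.
  simp only [curvature, hDΓ _ _ _ hac, hDΓ _ _ _ hbc, hsym.eq b a, hΓ z hz]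
  simp [hac, hbc, ham, hbm, hηr, hηs b a]
  ring

end IsMetricOn

end LeviCivita

end LocalSurface

/-! ### Derivatives and smooth fields in an arbitrary chart of the maximal atlas. -/

section Charts

open Bundle

variable {E : Type*} [NormedAddCommGroup E] [NormedSpace ℝ E]
  {M : Type*} [TopologicalSpace M] [ChartedSpace E M]
  {e : OpenPartialHomeomorph M E}

theorem OpenPartialHomeomorph.mdifferentiable_of_mem_maximalAtlas
    (he : e ∈ IsManifold.maximalAtlas 𝓘(ℝ, E) ∞ M) : e.MDifferentiable 𝓘(ℝ, E) 𝓘(ℝ, E) :=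
  ⟨(contMDiffOn_of_mem_maximalAtlas he).mdifferentiableOn (by simp),
    (contMDiffOn_symm_of_mem_maximalAtlas he).mdifferentiableOn (by simp)⟩

theorem inverse_mfderiv_of_mem_maximalAtlas (he : e ∈ IsManifold.maximalAtlas 𝓘(ℝ, E) ∞ M)
    {q : M} (hq : q ∈ e.source) : (mfderiv 𝓘(ℝ, E) 𝓘(ℝ, E) e q).IsInvertible ∧
      (mfderiv 𝓘(ℝ, E) 𝓘(ℝ, E) e q).inverse = mfderiv 𝓘(ℝ, E) 𝓘(ℝ, E) e.symm (e q) := by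
  have hd := OpenPartialHomeomorph.mdifferentiable_of_mem_maximalAtlas he
  have h1 : mfderiv 𝓘(ℝ, E) 𝓘(ℝ, E) e q = (hd.mfderiv hq : TangentSpace 𝓘(ℝ, E) q →L[ℝ] _) := rfl
  refine ⟨⟨_, h1.symm⟩, ?_⟩
  rw [h1, ContinuousLinearMap.inverse_equiv]
  rfl

/-- Chain rule for `h = (h ∘ e.symm) ∘ e` near the point. It reduces manifold derivatives to Fréchet
derivatives. -/
theorem mfderiv_eq_fderiv_comp_symm (he : e ∈ IsManifold.maximalAtlas 𝓘(ℝ, E) ∞ M) {z : E}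
    (hz : z ∈ e.target) {F : Type*} [NormedAddCommGroup F] [NormedSpace ℝ F] {h : M → F}
    (hh : DifferentiableAt ℝ (fun z ↦ h (e.symm z)) z) (u : TangentSpace 𝓘(ℝ, E) (e.symm z)) :
    mfderiv 𝓘(ℝ, E) 𝓘(ℝ, F) h (e.symm z) u
      = fderiv ℝ (fun z ↦ h (e.symm z)) z (mfderiv 𝓘(ℝ, E) 𝓘(ℝ, E) e (e.symm z) u) := by
  have hd := OpenPartialHomeomorph.mdifferentiable_of_mem_maximalAtlas he
  have hy := e.map_target hz
  have hev : h =ᶠ[𝓝 (e.symm z)] (fun z ↦ h (e.symm z)) ∘ e := by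
    filter_upwards [e.open_source.mem_nhds hy] with y hy
    simp [e.left_inv hy]
  have hh' : MDifferentiableAt 𝓘(ℝ, E) 𝓘(ℝ, F) (fun z ↦ h (e.symm z)) (e (e.symm z)) := by
    rw [e.right_inv hz]; exact hh.mdifferentiableAt
  rw [hev.mfderiv_eq, mfderiv_comp _ hh' (hd.mdifferentiableAt hy), mfderiv_eq_fderiv,
    e.right_inv hz]
  rfl

/-- The tangent maps of `e` and `e.symm` are smooth and mutually inverse, and over the model space
the tangent bundle is a product. This permits reading smoothness of fields in conformally flat
coordinates. -/
theorem contMDiffAt_tangent_iff [IsManifold 𝓘(ℝ, E) ∞ M] {E' : Type*} [NormedAddCommGroup E'] [NormedSpace ℝ E']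
    {P : Type*} [TopologicalSpace P] [ChartedSpace E' P] {F : P → M}
    {Z : ∀ p, TangentSpace 𝓘(ℝ, E) (F p)} {p₀ : P}
    (he : e ∈ IsManifold.maximalAtlas 𝓘(ℝ, E) ∞ M) (hp : F p₀ ∈ e.source)
    (hF : ContMDiffAt 𝓘(ℝ, E') 𝓘(ℝ, E) ∞ F p₀) :
    ContMDiffAt 𝓘(ℝ, E') 𝓘(ℝ, E).tangent ∞ (fun p ↦ (⟨F p, Z p⟩ : TangentBundle 𝓘(ℝ, E) M)) p₀ ↔
      ContMDiffAt 𝓘(ℝ, E') 𝓘(ℝ, E) ∞ (fun p ↦ (mfderiv 𝓘(ℝ, E) 𝓘(ℝ, E) e (F p) (Z p) : E)) p₀ := by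
  have hev : ∀ᶠ p in 𝓝 p₀, F p ∈ e.source :=
    hF.continuousAt.eventually_mem (e.open_source.mem_nhds hp)
  constructor
  · intro h
    have h1 := (contMDiffOn_of_mem_maximalAtlas he).contMDiffOn_tangentMapWithin (m := ∞) (by simp)
      e.open_source.uniqueMDiffOn
    have h2 : ContMDiffAt 𝓘(ℝ, E).tangent 𝓘(ℝ, E).tangent ∞
        (tangentMapWithin 𝓘(ℝ, E) 𝓘(ℝ, E) e e.source) ⟨F p₀, Z p₀⟩ :=
      h1.contMDiffAt ((e.open_source.preimage (FiberBundle.continuous_proj E _)).mem_nhds hp)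
    have h3 := ((contMDiff_snd_tangentBundle_modelSpace E 𝓘(ℝ, E)).contMDiffAt.comp _ h2).comp p₀ h
    refine h3.congr_of_eventuallyEq (hev.mono fun p hp ↦ ?_)
    simp only [Function.comp, tangentMapWithin]
    rw [mfderivWithin_of_isOpen e.open_source hp]
  · intro h
    have h1 := (contMDiffOn_symm_of_mem_maximalAtlas he).contMDiffOn_tangentMapWithin (m := ∞)
      (by simp) e.open_target.uniqueMDiffOn
    have h2 : ContMDiffAt 𝓘(ℝ, E).tangent 𝓘(ℝ, E).tangent ∞
        (tangentMapWithin 𝓘(ℝ, E) 𝓘(ℝ, E) e.symm e.target)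
          ⟨e (F p₀), mfderiv 𝓘(ℝ, E) 𝓘(ℝ, E) e (F p₀) (Z p₀)⟩ :=
      h1.contMDiffAt ((e.open_target.preimage (FiberBundle.continuous_proj E _)).mem_nhds
        (e.map_source hp))
    have h3 : ContMDiffAt 𝓘(ℝ, E') 𝓘(ℝ, E).tangent ∞ (fun p ↦
        (⟨e (F p), mfderiv 𝓘(ℝ, E) 𝓘(ℝ, E) e (F p) (Z p)⟩ : TangentBundle 𝓘(ℝ, E) E)) p₀ := by
      have h4 : ContMDiffAt 𝓘(ℝ, E') (𝓘(ℝ, E).prod 𝓘(ℝ, E)) ∞ (fun p ↦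
          ((e (F p), mfderiv 𝓘(ℝ, E) 𝓘(ℝ, E) e (F p) (Z p)) : E × E)) p₀ :=
        ((contMDiffAt_of_mem_maximalAtlas he hp).comp p₀ hF).prodMk h
      rw [chartedSpaceSelf_prod] at h4
      exact (contMDiff_tangentBundleModelSpaceHomeomorph_symm (I := 𝓘(ℝ, E))).contMDiffAt.comp p₀ h4
    refine (h2.comp p₀ h3).congr_of_eventuallyEq (hev.mono fun p hp ↦ ?_)
    obtain ⟨⟨L, hL⟩, hi⟩ := inverse_mfderiv_of_mem_maximalAtlas he hp
    simp only [Function.comp, tangentMapWithin]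
    rw [mfderivWithin_of_isOpen e.open_target (e.map_source hp), ← hi, ← hL,
      ContinuousLinearMap.inverse_equiv]
    have key : ∀ q (v : TangentSpace 𝓘(ℝ, E) q) (w : TangentSpace 𝓘(ℝ, E) (F p)), q = F p →
      (v : E) = w → (⟨F p, w⟩ : TangentBundle 𝓘(ℝ, E) M) = ⟨q, v⟩ := by
      rintro q v w rfl h; rw [← h]
    exact key _ _ _ (e.left_inv hp) (L.symm_apply_apply (Z p))

end Charts

/-! ### The spacetime metric and its curvature in a chart. -/

namespace SpacetimeSurface

open LocalSurface

variable {V : Type*} [TopologicalSpace V] [ChartedSpace E4 V] {e : OpenPartialHomeomorph V E4}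

theorem isInvertible_coord (he : e ∈ IsManifold.maximalAtlas (𝓡 4) ∞ V) {q : V}
    (hq : q ∈ e.source) : (coord e q).IsInvertible :=
  (inverse_mfderiv_of_mem_maximalAtlas he hq).1

theorem inverse_coord_apply (he : e ∈ IsManifold.maximalAtlas (𝓡 4) ∞ V) {q : V}
    (hq : q ∈ e.source) (v : TangentSpace (𝓡 4) q) : (coord e q).inverse (coord e q v) = v := by
  obtain ⟨L, hL⟩ := isInvertible_coord he hq
  rw [← hL, ContinuousLinearMap.inverse_equiv]
  exact L.symm_apply_apply v

theorem coord_inverse_apply (he : e ∈ IsManifold.maximalAtlas (𝓡 4) ∞ V) {q : V}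
    (hq : q ∈ e.source) (a : E4) : coord e q ((coord e q).inverse a) = a := by
  obtain ⟨L, hL⟩ := isInvertible_coord he hq
  rw [← hL, ContinuousLinearMap.inverse_equiv]
  exact L.apply_symm_apply a

variable [IsManifold (𝓡 4) ∞ V]

/-- The metric in the chart `e`, as a bilinear form on `ℝ⁴`. -/
def localMetric (g : LorentzMetric V) (e : OpenPartialHomeomorph V E4) (z : E4) :
    E4 →L[ℝ] E4 →L[ℝ] ℝ :=
  ContinuousLinearMap.bilinearComp (E := E4) (F := E4) (E' := E4) (F' := E4)
    (show E4 →L[ℝ] E4 →L[ℝ] ℝ from g.val (e.symm z))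
    (show E4 →L[ℝ] E4 from (coord e (e.symm z)).inverse)
    (show E4 →L[ℝ] E4 from (coord e (e.symm z)).inverse)

theorem localMetric_apply (g : LorentzMetric V) (e : OpenPartialHomeomorph V E4) (z a b : E4) :
    localMetric g e z a b
      = g.val (e.symm z) ((coord e (e.symm z)).inverse a) ((coord e (e.symm z)).inverse b) := rfl

theorem metricMatrix_apply (g : LorentzMetric V) (e : OpenPartialHomeomorph V E4) (z : E4)
    (i j : Fin 4) : metricMatrix g e z i j
      = localMetric g e z (EuclideanSpace.single i 1) (EuclideanSpace.single j 1) := rfl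

theorem localMetric_coord (g : LorentzMetric V) (he : e ∈ IsManifold.maximalAtlas (𝓡 4) ∞ V)
    {q : V} (hq : q ∈ e.source) (v w : TangentSpace (𝓡 4) q) :
    localMetric g e (e q) (coord e q v) (coord e q w) = g.val q v w := by
  have key : ∀ p, p = q → ∀ v w : TangentSpace (𝓡 4) q,
      g.val p ((coord e p).inverse (coord e q v)) ((coord e p).inverse (coord e q w))
        = g.val q v w := by
    rintro p rfl v w
    rw [inverse_coord_apply he hq, inverse_coord_apply he hq]
  exact key _ (e.left_inv hq) v w

theorem minkowski_nondegenerate {a : E4} (ha : ∀ b, minkowski a b = 0) : a = 0 := by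
  ext i
  have := ha (EuclideanSpace.single i 1)
  fin_cases i <;> simpa [minkowski] using this

theorem LorentzMetric.nondegenerate (g : LorentzMetric V) {q : V} {v : TangentSpace (𝓡 4) q}
    (hv : ∀ w, g.val q v w = 0) : v = 0 := by
  obtain ⟨L, hL⟩ := g.signature q
  have : L v = 0 := minkowski_nondegenerate fun b ↦ by
    have := hv (L.symm b)
    rwa [hL, L.apply_symm_apply] at this
  simpa using this

/-- Smoothness may be tested on constant vectors `a, b`, whose preimages are smooth sections of the
tangent bundle. The smooth metric is then evaluated on these sections. -/
theorem contDiffOn_localMetric (g : LorentzMetric V)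
    (he : e ∈ IsManifold.maximalAtlas (𝓡 4) ∞ V) : ContDiffOn ℝ ∞ (localMetric g e) e.target := by
  refine contDiffOn_clm_apply.2 fun a ↦ contDiffOn_clm_apply.2 fun b z hz ↦
    ContDiffAt.contDiffWithinAt ?_
  have hs : ContMDiffAt 𝓘(ℝ, E4) (𝓡 4) ∞ e.symm z :=
    (contMDiffOn_symm_of_mem_maximalAtlas he).contMDiffAt (e.open_target.mem_nhds hz)
  have hsec : ∀ a : E4, ContMDiffAt 𝓘(ℝ, E4) (𝓡 4).tangent ∞ (fun y ↦
      (⟨e.symm y, (coord e (e.symm y)).inverse a⟩ : TangentBundle (𝓡 4) V)) z := fun a ↦ by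
    refine (contMDiffAt_tangent_iff he (e.map_target hz) hs).2 ?_
    refine (contMDiffAt_const (c := a)).congr_of_eventuallyEq ?_
    filter_upwards [e.open_target.mem_nhds hz] with y hy
    exact coord_inverse_apply he (e.map_target hy) a
  have := ContMDiffAt.clm_bundle_apply₂ (F₁ := E4) (F₂ := E4) (F₃ := ℝ) 
    (E₃ := fun _ ↦ ℝ) (g.contMDiff.contMDiffAt.comp z hs) (hsec a) (hsec b)
  simp only [Bundle.contMDiffAt_totalSpace] at this
  exact this.2.contDiffAt

theorem isMetricOn_localMetric (g : LorentzMetric V)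
    (he : e ∈ IsManifold.maximalAtlas (𝓡 4) ∞ V) : IsMetricOn (localMetric g e) e.target where
  isOpen := e.open_target
  contDiffOn := contDiffOn_localMetric g he
  symm z _ a b := g.symm (e.symm z) ((coord e (e.symm z)).inverse a) _
  nondegenerate z hz a ha := by
    have hq := e.map_target hz
    have h0 : (coord e (e.symm z)).inverse a = 0 := g.nondegenerate fun w ↦ by
      have := ha (coord e (e.symm z) w)
      rwa [localMetric_apply, inverse_coord_apply he hq] at this
    rw [← coord_inverse_apply he hq a, h0, map_zero]

/-- The index formula and the invariant one both solve the Koszul equation, whose solution is unique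
by nondegeneracy. The matrix inverse is a true inverse for the same reason. -/
theorem christoffel_eq (g : LorentzMetric V) (he : e ∈ IsManifold.maximalAtlas (𝓡 4) ∞ V) {z : E4}
    (hz : z ∈ e.target) (a b : E4) :
    christoffel g e z a b = leviCivita (localMetric g e) z a b := by
  have hm := isMetricOn_localMetric g he
  set G := localMetric g e with hG
  have hd : ∀ i j k, dMetric g e z i j k = fderiv ℝ G z (EuclideanSpace.single i 1)
      (EuclideanSpace.single j 1) (EuclideanSpace.single k 1) := by
    intro i j k
    have h1 := ((hm.hasFDerivAt hz).clm_apply (hasFDerivAt_const (EuclideanSpace.single j 1) z)).clm_apply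
      (hasFDerivAt_const (EuclideanSpace.single k 1) z)
    simp only [dMetric, metricMatrix_apply]
    rw [h1.fderiv]
    simp
  have hexp : ∀ a : E4, a = ∑ i, a i • (EuclideanSpace.single i (1 : ℝ) : E4) := by
    intro a
    ext j
    simp [Finset.sum_apply, Pi.single_apply]
  have hGM : ∀ a b : E4, G z a b = a.ofLp ⬝ᵥ (metricMatrix g e z).mulVec b.ofLp := by
    intro a b
    conv_lhs => rw [hexp a, hexp b]
    simp only [map_sum, map_smul, sum_apply, smul_apply, smul_eq_mul, Matrix.mulVec, dotProduct,
      metricMatrix_apply, ← hG, Finset.mul_sum]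
    rw [Finset.sum_comm]
    exact Finset.sum_congr rfl fun i _ ↦ Finset.sum_congr rfl fun j _ ↦ by ring
  have hdet : IsUnit (metricMatrix g e z).det := by
    rw [isUnit_iff_ne_zero]
    intro h0
    obtain ⟨v, hv, hv0⟩ := Matrix.exists_mulVec_eq_zero_iff.2 h0
    refine hv ?_
    have : (WithLp.toLp 2 v : E4) = 0 := hm.nondegenerate z hz _ fun b ↦ by
      rw [hm.symm z hz, hGM]
      have h1 := congrArg (fun w ↦ b.ofLp ⬝ᵥ w) hv0
      simpa using h1
    simpa using this
  have hchr : (christoffel g e z a b).ofLp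
      = (metricMatrix g e z)⁻¹.mulVec fun l ↦ koszul G z a b (EuclideanSpace.single l 1) := by
    ext k
    simp only [christoffel, christoffelSymbol, Matrix.mulVec, dotProduct, hd]
    have hT : ∀ l : Fin 4, koszul G z a b (EuclideanSpace.single l 1)
        = ∑ i, ∑ j, a i * (b j * koszul G z (EuclideanSpace.single i 1) (EuclideanSpace.single j 1)
          (EuclideanSpace.single l 1)) := by
      intro l
      conv_lhs => rw [hexp a, hexp b]
      simp only [map_sum, map_smul, sum_apply, smul_apply, smul_eq_mul, Finset.mul_sum]
      rw [Finset.sum_comm]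
      exact Finset.sum_congr rfl fun i _ ↦ Finset.sum_congr rfl fun j _ ↦ by ring
    simp only [hT, koszul_apply, Finset.mul_sum, Finset.sum_mul]
    refine (Finset.sum_congr rfl fun i _ ↦ Finset.sum_comm).trans (Finset.sum_comm.trans ?_)
    exact Finset.sum_congr rfl fun l _ ↦ Finset.sum_congr rfl fun i _ ↦
      Finset.sum_congr rfl fun j _ ↦ by ring
  refine (hm.leviCivita_eq hz fun c ↦ ?_).symm
  rw [hm.symm z hz, hGM, hchr, Matrix.mulVec_mulVec, Matrix.mul_nonsing_inv _ hdet,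
    Matrix.one_mulVec]
  conv_rhs => rw [hexp c]
  simp [dotProduct]

theorem riemannIn_eq (g : LorentzMetric V) (he : e ∈ IsManifold.maximalAtlas (𝓡 4) ∞ V) {z : E4}
    (hz : z ∈ e.target) (a b c : E4) :
    riemannIn g e z a b c = curvature (leviCivita (localMetric g e)) z a b c := by
  have hm := isMetricOn_localMetric g he
  have hΓ : HasFDerivAt (leviCivita (localMetric g e)) (fderiv ℝ (leviCivita (localMetric g e)) z) z :=
    ((hm.contDiffOn_leviCivita.contDiffAt (hm.isOpen.mem_nhds hz)).differentiableAt
      (by simp)).hasFDerivAt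
  have hd : ∀ b c a, fderiv ℝ (fun y ↦ christoffel g e y b c) z a
      = fderiv ℝ (leviCivita (localMetric g e)) z a b c := by
    intro b c a
    have h1 := (hΓ.clm_apply (hasFDerivAt_const b z)).clm_apply (hasFDerivAt_const c z)
    have h2 := h1.congr_of_eventuallyEq (f₁ := fun y ↦ christoffel g e y b c)
      (Filter.eventually_of_mem (hm.isOpen.mem_nhds hz) fun y hy ↦ christoffel_eq g he hy b c)
    rw [h2.fderiv]
    simp
  simp only [riemannIn, curvature, hd, christoffel_eq g he hz]

/-- The Minkowski scalar product as a continuous bilinear form. -/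
def minkowskiForm : E4 →L[ℝ] E4 →L[ℝ] ℝ :=
  (LinearMap.mk₂ ℝ minkowski (fun _ _ _ ↦ by simp [minkowski]; ring)
    (fun _ _ _ ↦ by simp [minkowski]; ring) (fun _ _ _ ↦ by simp [minkowski]; ring)
    (fun _ _ _ ↦ by simp [minkowski]; ring)).toContinuousBilinearMap

/-- The curvature assumption on the spacetime, in a suitable chart around any point. -/
theorem exists_chart_curvaturePreservesSplitting (g : LorentzMetric V)
    (hg : IsLocallyConformallyFlat g ∨ ∃ K : ℝ, HasConstantCurvature g K) (p : V) :
    ∃ e ∈ IsManifold.maximalAtlas (𝓡 4) ∞ V, p ∈ e.source ∧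
      CurvaturePreservesSplitting (localMetric g e) (leviCivita (localMetric g e)) (e p) := by
  rcases hg with hflat | ⟨K, hK⟩
  · obtain ⟨e, he, hp, Ω, hΩ, hmet⟩ := hflat p
    refine ⟨e, he, hp, (isMetricOn_localMetric g he).curvaturePreservesSplitting_of_conformal
      (e.map_source hp) (η := minkowskiForm) (Ω := fun y ↦ Ω (e.symm y)) ?_
      (fun y hy ↦ (hmet _ (e.map_target hy)).1) fun y hy ↦ ?_⟩
    · exact (hΩ.comp (contMDiffOn_symm_of_mem_maximalAtlas he) fun y hy ↦
        e.map_target hy).contDiffOn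
    · ext a b
      rw [localMetric_apply, (hmet _ (e.map_target hy)).2, coord_inverse_apply he (e.map_target hy),
        coord_inverse_apply he (e.map_target hy)]
      rfl
  · have he : chartAt E4 p ∈ IsManifold.maximalAtlas (𝓡 4) ∞ V :=
      IsManifold.chart_mem_maximalAtlas p
    have hp := mem_chart_source E4 p
    refine ⟨chartAt E4 p, he, hp, fun a b c m hac hbc _ _ ↦ ?_⟩
    set e := chartAt E4 p
    obtain ⟨u, rfl⟩ : ∃ u, coord e p u = a := ⟨_, coord_inverse_apply he hp a⟩
    obtain ⟨v, rfl⟩ : ∃ v, coord e p v = b := ⟨_, coord_inverse_apply he hp b⟩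
    obtain ⟨w, rfl⟩ : ∃ w, coord e p w = c := ⟨_, coord_inverse_apply he hp c⟩
    -- In a space form `R(u,v)w` is a combination of `u` and `v` with coefficients `⟨v,w⟩` and
    -- `⟨u,w⟩`, both zero here.
    rw [localMetric_coord g he hp] at hac hbc
    have h1 := congrArg (coord e p) (hK p u v w)
    rw [hac, hbc, riemann, coord_inverse_apply he hp, riemannIn_eq g he (e.map_source hp)] at h1
    rw [h1]
    simp

end SpacetimeSurface

namespace SpacetimeSurface

open LocalSurface

/-! ### Vector fields and Lie brackets of the surface in a chart. -/

section SurfaceChart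

variable {S : Type*} [TopologicalSpace S] [ChartedSpace E2 S] {φ : OpenPartialHomeomorph S E2}

/-- The components of tangent vectors of the surface in the chart `φ`. -/
def surfaceCoord (φ : OpenPartialHomeomorph S E2) (y : S) : TangentSpace (𝓡 2) y →L[ℝ] E2 :=
  mfderiv (𝓡 2) 𝓘(ℝ, E2) φ y

/-- A tangent vector field of the surface in the chart `φ`. -/
def localVectorField (φ : OpenPartialHomeomorph S E2) (X : ∀ y : S, TangentSpace (𝓡 2) y) (s : E2) :
    E2 :=
  surfaceCoord φ (φ.symm s) (X (φ.symm s))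

theorem surfaceCoord_inverse_apply (hφ : φ ∈ IsManifold.maximalAtlas (𝓡 2) ∞ S) {y : S}
    (hy : y ∈ φ.source) (a : E2) : surfaceCoord φ y ((surfaceCoord φ y).inverse a) = a := by
  obtain ⟨L, hL⟩ : (surfaceCoord φ y).IsInvertible := (inverse_mfderiv_of_mem_maximalAtlas hφ hy).1
  rw [← hL, ContinuousLinearMap.inverse_equiv]
  exact L.apply_symm_apply a

theorem surfaceCoord_injective (hφ : φ ∈ IsManifold.maximalAtlas (𝓡 2) ∞ S) {y : S}
    (hy : y ∈ φ.source) : Function.Injective (surfaceCoord φ y) := by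
  obtain ⟨L, hL⟩ : (surfaceCoord φ y).IsInvertible := (inverse_mfderiv_of_mem_maximalAtlas hφ hy).1
  rw [← hL]
  exact L.injective

/-- The manifold bracket at a point is defined by pulling back through the preferred chart there, so
for that chart only the germs of the pulled-back fields have to be matched. -/
theorem surfaceCoord_mlieBracket [IsManifold (𝓡 2) ∞ S] {s : E2} (hs : s ∈ φ.target)
    (hφ : φ = chartAt E2 (φ.symm s)) (X Y : ∀ y : S, TangentSpace (𝓡 2) y) :
    surfaceCoord φ (φ.symm s) (VectorField.mlieBracket (𝓡 2) X Y (φ.symm s))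
      = VectorField.lieBracket ℝ (localVectorField φ X) (localVectorField φ Y) s := by
  have hmem : φ ∈ IsManifold.maximalAtlas (𝓡 2) ∞ S := by
    rw [hφ]; exact IsManifold.chart_mem_maximalAtlas _
  have hloc : ∀ Z : ∀ y : S, TangentSpace (𝓡 2) y,
      VectorField.mpullbackWithin 𝓘(ℝ, E2) (𝓡 2) φ.symm Z Set.univ =ᶠ[𝓝 s] localVectorField φ Z := by
    intro Z
    filter_upwards [φ.open_target.mem_nhds hs] with t ht
    have hd := (OpenPartialHomeomorph.mdifferentiable_of_mem_maximalAtlas hmem).symm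
    have h1 : mfderiv 𝓘(ℝ, E2) (𝓡 2) φ.symm t
        = (hd.mfderiv ht : TangentSpace 𝓘(ℝ, E2) t →L[ℝ] TangentSpace (𝓡 2) (φ.symm t)) := rfl
    rw [VectorField.mpullbackWithin_apply, mfderivWithin_univ, h1,
      ContinuousLinearMap.inverse_equiv]
    rfl
  have hext : (extChartAt (𝓡 2) (φ.symm s) : S → E2) = φ := by
    rw [extChartAt_coe, ← hφ]; rfl
  have hext' : ((extChartAt (𝓡 2) (φ.symm s)).symm : E2 → S) = φ.symm := by
    rw [extChartAt_coe_symm, ← hφ]; rfl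
  have hbr : ∀ {A B A' B' : E2 → E2}, A =ᶠ[𝓝 s] A' → B =ᶠ[𝓝 s] B' →
      VectorField.lieBracketWithin ℝ A B Set.univ s = VectorField.lieBracket ℝ A' B' s := by
    intro A B A' B' hA hB
    rw [VectorField.lieBracketWithin_univ, hA.lieBracket_vectorField_eq hB]
  -- The extended chart, its inverse and the base point are generalized, so that they can be
  -- replaced by `φ`, `φ.symm` and `s` despite the dependent types.
  have key : ∀ (p : S → E2) (q : E2 → S) (t : E2), p = φ → q = φ.symm → t = s →
      surfaceCoord φ (φ.symm s) ((mfderiv (𝓡 2) 𝓘(ℝ, E2) p (φ.symm s)).inverse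
        (VectorField.lieBracketWithin ℝ (E := E2)
          (VectorField.mpullbackWithin 𝓘(ℝ, E2) (𝓡 2) q X Set.univ)
          (VectorField.mpullbackWithin 𝓘(ℝ, E2) (𝓡 2) q Y Set.univ) Set.univ t))
        = VectorField.lieBracket ℝ (localVectorField φ X) (localVectorField φ Y) s := by
    rintro _ _ _ rfl rfl rfl
    refine (congrArg (fun w : E2 ↦ surfaceCoord φ _ ((surfaceCoord φ _).inverse w))
      (hbr (hloc X) (hloc Y))).trans (surfaceCoord_inverse_apply hmem (φ.map_target hs) _)
  rw [← VectorField.mlieBracketWithin_univ, VectorField.mlieBracketWithin_apply,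
    ModelWithCorners.range_eq_univ, Set.preimage_univ, Set.univ_inter]
  exact key _ _ _ hext hext' ((congrFun hext _).trans (φ.right_inv hs))

end SurfaceChart

/-! ### Extrinsic geometry of the surface expressed in charts. -/

section Transfer

variable {V : Type*} [TopologicalSpace V] {S : Type*} [TopologicalSpace S] {Φ : S → V}
  {e : OpenPartialHomeomorph V E4} {φ : OpenPartialHomeomorph S E2} {s : E2}

/-- The map `Φ` in the charts `φ` and `e`. -/
def localMap (Φ : S → V) (e : OpenPartialHomeomorph V E4) (φ : OpenPartialHomeomorph S E2) (s : E2) :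
    E4 :=
  e (Φ (φ.symm s))

/-- The domain of the map `Φ` in the charts `φ` and `e`. -/
def localDomain (Φ : S → V) (e : OpenPartialHomeomorph V E4) (φ : OpenPartialHomeomorph S E2) :
    Set E2 :=
  φ.target ∩ φ.symm ⁻¹' (Φ ⁻¹' e.source)

theorem isOpen_localDomain (hΦ : Continuous Φ) : IsOpen (localDomain Φ e φ) :=
  φ.symm.isOpen_inter_preimage (e.open_source.preimage hΦ)

variable [ChartedSpace E4 V]

/-- A field along `Φ` in the charts `φ` and `e`. -/
def localField (Φ : S → V) (e : OpenPartialHomeomorph V E4) (φ : OpenPartialHomeomorph S E2)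
    (N : ∀ y : S, TangentSpace (𝓡 4) (Φ y)) (s : E2) : E4 :=
  coord e (Φ (φ.symm s)) (N (φ.symm s))

/-- The field along `Φ` with given components in the charts `φ` and `e`. -/
def globalField (Φ : S → V) (e : OpenPartialHomeomorph V E4) (φ : OpenPartialHomeomorph S E2)
    (M : E2 → E4) (y : S) : TangentSpace (𝓡 4) (Φ y) :=
  (coord e (Φ y)).inverse (M (φ y))

theorem localField_globalField (he : e ∈ IsManifold.maximalAtlas (𝓡 4) ∞ V)
    (hs : s ∈ localDomain Φ e φ) (M : E2 → E4) :
    localField Φ e φ (globalField Φ e φ M) s = M s := by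
  rw [localField, globalField, coord_inverse_apply he hs.2, φ.right_inv hs.1]

variable [ChartedSpace E2 S]

theorem contDiffAt_localMap (hΦ : ContMDiff (𝓡 2) (𝓡 4) ∞ Φ)
    (he : e ∈ IsManifold.maximalAtlas (𝓡 4) ∞ V) (hφ : φ ∈ IsManifold.maximalAtlas (𝓡 2) ∞ S)
    (hs : s ∈ localDomain Φ e φ) : ContDiffAt ℝ ∞ (localMap Φ e φ) s :=
  ((contMDiffAt_of_mem_maximalAtlas he hs.2).comp s (hΦ.contMDiffAt.comp s
    (contMDiffAt_symm_of_mem_maximalAtlas hφ hs.1))).contDiffAt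

theorem fderiv_localMap (hΦ : ContMDiff (𝓡 2) (𝓡 4) ∞ Φ)
    (he : e ∈ IsManifold.maximalAtlas (𝓡 4) ∞ V) (hφ : φ ∈ IsManifold.maximalAtlas (𝓡 2) ∞ S)
    (hs : s ∈ localDomain Φ e φ) (u : TangentSpace (𝓡 2) (φ.symm s)) :
    fderiv ℝ (localMap Φ e φ) s (surfaceCoord φ (φ.symm s) u)
      = coord e (Φ (φ.symm s)) (diff Φ (φ.symm s) u) := by
  have h1 := mfderiv_eq_fderiv_comp_symm hφ hs.1 (h := fun y ↦ e (Φ y))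
    ((contDiffAt_localMap hΦ he hφ hs).differentiableAt (by simp)) u
  refine h1.symm.trans ?_
  have h2 := mfderiv_comp (φ.symm s)
    ((OpenPartialHomeomorph.mdifferentiable_of_mem_maximalAtlas he).mdifferentiableAt hs.2)
    (hΦ.mdifferentiableAt (by simp))
  exact congrArg (fun l ↦ l u) h2

/-- The differential of a change of charts. -/
theorem fderiv_chart_change {e' : OpenPartialHomeomorph V E4}
    (he : e ∈ IsManifold.maximalAtlas (𝓡 4) ∞ V) (he' : e' ∈ IsManifold.maximalAtlas (𝓡 4) ∞ V)
    {q : V} (hq : q ∈ e.source) (hq' : q ∈ e'.source) :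
    ContDiffAt ℝ ∞ (fun z ↦ e' (e.symm z)) (e q) ∧ ∀ v : TangentSpace (𝓡 4) q,
      fderiv ℝ (fun z ↦ e' (e.symm z)) (e q) (coord e q v) = coord e' q v := by
  obtain ⟨z, hz, rfl⟩ : ∃ z ∈ e.target, e.symm z = q := ⟨e q, e.map_source hq, e.left_inv hq⟩
  have hc : ContDiffAt ℝ ∞ (fun z ↦ e' (e.symm z)) z :=
    ((contMDiffAt_of_mem_maximalAtlas he' hq').comp z
      (contMDiffAt_symm_of_mem_maximalAtlas he hz)).contDiffAt
  rw [e.right_inv hz]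
  exact ⟨hc, fun v ↦
    (mfderiv_eq_fderiv_comp_symm he hz (h := e') (hc.differentiableAt (by simp)) v).symm⟩

variable [IsManifold (𝓡 4) ∞ V] {g : LorentzMetric V}

theorem exists_eq_sum_basisVec (x : S) (u : TangentSpace (𝓡 2) x) :
    ∃ c : Fin 2 → ℝ, u = ∑ i, c i • basisVec x i := by
  have h : ∀ a : E2, a = ∑ i, a i • (EuclideanSpace.single i (1 : ℝ) : E2) := by
    intro a
    ext j
    fin_cases j <;> simp
  exact ⟨_, h u⟩

theorem val_diff_sum_basisVec (g : LorentzMetric V) (Φ : S → V) (x : S) (c d : Fin 2 → ℝ) :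
    g.val (Φ x) (diff Φ x (∑ i, c i • basisVec x i)) (diff Φ x (∑ i, d i • basisVec x i))
      = c ⬝ᵥ (firstFundamentalMatrix g Φ x).mulVec d := by
  simp only [map_sum, map_smul, sum_apply, smul_apply, smul_eq_mul, Matrix.mulVec, dotProduct,
    firstFundamentalMatrix, Matrix.of_apply, Finset.mul_sum]
  rw [Finset.sum_comm]
  exact Finset.sum_congr rfl fun i _ ↦ Finset.sum_congr rfl fun j _ ↦ by ring

theorem isImmersion_localMap (h : IsSpacelikeImmersion g Φ)
    (he : e ∈ IsManifold.maximalAtlas (𝓡 4) ∞ V) (hφ : φ ∈ IsManifold.maximalAtlas (𝓡 2) ∞ S) :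
    IsImmersion (localMetric g e) (leviCivita (localMetric g e)) (localMap Φ e φ)
      (localDomain Φ e φ) e.target where
  isOpen_source := isOpen_localDomain h.smooth.continuous
  isOpen_target := e.open_target
  mapsTo _ hs := e.map_source hs.2
  contDiffOn_metric := contDiffOn_localMetric g he
  contDiffOn_christoffel := (isMetricOn_localMetric g he).contDiffOn_leviCivita
  contDiffOn _ hs := (contDiffAt_localMap h.smooth he hφ hs).contDiffWithinAt
  metric_symm := (isMetricOn_localMetric g he).symm
  christoffel_symm _ hz := (isMetricOn_localMetric g he).leviCivita_symm hz
  fderiv_metric _ hz := (isMetricOn_localMetric g he).fderiv_metric hz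
  pos s hs u hu := by
    have hy := φ.map_target hs.1
    have h1 := surfaceCoord_inverse_apply hφ hy u
    rw [← h1, fderiv_localMap h.smooth he hφ hs, localMap, localMetric_coord g he hs.2]
    refine h.spacelike _ _ fun h0 ↦ hu ?_
    rw [← h1, h0, map_zero]

/-- The covariant derivative does not depend on the chart. -/
theorem coord_covAlong (hΦ : ContMDiff (𝓡 2) (𝓡 4) ∞ Φ)
    (he : e ∈ IsManifold.maximalAtlas (𝓡 4) ∞ V) (hφ : φ ∈ IsManifold.maximalAtlas (𝓡 2) ∞ S)
    (hs : s ∈ localDomain Φ e φ) {Z : ∀ y : S, TangentSpace (𝓡 4) (Φ y)}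
    (hZ : DifferentiableAt ℝ (localField Φ e φ Z) s) (u : TangentSpace (𝓡 2) (φ.symm s)) :
    coord e (Φ (φ.symm s)) (covAlong g Φ Z (φ.symm s) u)
      = cov (leviCivita (localMetric g e)) (localMap Φ e φ) (localField Φ e φ Z) s
          (surfaceCoord φ (φ.symm s) u) := by
  have he' : chartAt E4 (Φ (φ.symm s)) ∈ IsManifold.maximalAtlas (𝓡 4) ∞ V :=
    IsManifold.chart_mem_maximalAtlas _
  have hq' := mem_chart_source E4 (Φ (φ.symm s))
  rw [covAlong]
  set e' := chartAt E4 (Φ (φ.symm s))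
  -- Covariant derivatives along `Φ` are defined in the preferred chart `e'`, while the computation
  -- takes place in `e`. The transition map `τ` relates the two.
  set τ : E4 → E4 := fun z ↦ e' (e.symm z)
  obtain ⟨hτ, hτd⟩ := fderiv_chart_change he he' hs.2 hq'
  have hτz : τ (localMap Φ e φ s) = e' (Φ (φ.symm s)) := congrArg e' (e.left_inv hs.2)
  have hinj : Function.Injective (fderiv ℝ τ (localMap Φ e φ s)) := by
    rw [injective_iff_map_eq_zero]
    intro a ha
    have h1 := hτd ((coord e (Φ (φ.symm s))).inverse a)
    rw [coord_inverse_apply he hs.2] at h1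
    have h2 := inverse_coord_apply he' hq' ((coord e (Φ (φ.symm s))).inverse a)
    rw [← h1, show fderiv ℝ τ (e (Φ (φ.symm s))) a = 0 from ha, map_zero] at h2
    rw [← coord_inverse_apply he hs.2 a, ← h2, map_zero]
  have hsurj : Function.Surjective (fderiv ℝ τ (localMap Φ e φ s)) :=
    LinearMap.injective_iff_surjective (f := (fderiv ℝ τ (localMap Φ e φ s) : E4 →ₗ[ℝ] E4)) |>.1 hinj
  have hmet : ∀ᶠ z in 𝓝 (localMap Φ e φ s), ∀ a b, localMetric g e z a b
      = localMetric g e' (τ z) (fderiv ℝ τ z a) (fderiv ℝ τ z b) := by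
    have hz : localMap Φ e φ s ∈ e.target := e.map_source hs.2
    have hev : ∀ᶠ z in 𝓝 (localMap Φ e φ s), e.symm z ∈ e'.source :=
      (e.symm.continuousAt hz).eventually_mem (e'.open_source.mem_nhds (by
        rw [localMap, e.left_inv hs.2]; exact hq'))
    filter_upwards [hev, e.open_target.mem_nhds hz] with z hz' hz a b
    have h1 := (fderiv_chart_change he he' (e.map_target hz) hz').2
    have h2 := fun v w ↦ localMetric_coord g he (e.map_target hz) v w
    rw [e.right_inv hz] at h1 h2
    rw [← coord_inverse_apply he (e.map_target hz) a, ← coord_inverse_apply he (e.map_target hz) b,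
      h1, h1, h2, localMetric_coord g he' hz']
  have hΓ : ∀ a b, fderiv ℝ τ (localMap Φ e φ s)
      (leviCivita (localMetric g e) (localMap Φ e φ s) a b)
      = fderiv ℝ (fderiv ℝ τ) (localMap Φ e φ s) a b
        + leviCivita (localMetric g e') (τ (localMap Φ e φ s)) (fderiv ℝ τ (localMap Φ e φ s) a)
          (fderiv ℝ τ (localMap Φ e φ s) b) :=
    (isMetricOn_localMetric g he).leviCivita_transform (isMetricOn_localMetric g he')
      (e.map_source hs.2) (hτz ▸ e'.map_source hq') hτ hsurj hmet
  have hloc : (fun t ↦ coord e' (Φ (φ.symm t)) (Z (φ.symm t))) =ᶠ[𝓝 s]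
      fun t ↦ fderiv ℝ τ (localMap Φ e φ t) (localField Φ e φ Z t) := by
    have hev : ∀ᶠ t in 𝓝 s, Φ (φ.symm t) ∈ e'.source :=
      (hΦ.continuous.continuousAt.comp (φ.symm.continuousAt hs.1)).eventually_mem
        (e'.open_source.mem_nhds hq')
    filter_upwards [hev, (isOpen_localDomain hΦ.continuous).mem_nhds hs] with t ht hts
    exact ((fderiv_chart_change he he' hts.2 ht).2 _).symm
  have hτ2 : HasFDerivAt (fderiv ℝ τ) (fderiv ℝ (fderiv ℝ τ) (localMap Φ e φ s))
      (localMap Φ e φ s) :=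
    ((hτ.fderiv_right (m := ∞) (by simp)).differentiableAt (by simp)).hasFDerivAt
  have hfd := ((contDiffAt_localMap hΦ he hφ hs).differentiableAt (by simp)).hasFDerivAt
  have hD := ((hτ2.comp s hfd).clm_apply hZ.hasFDerivAt).congr_of_eventuallyEq hloc
  have hdc : dComponents Φ Z (φ.symm s) u
      = fderiv ℝ (fderiv ℝ τ) (localMap Φ e φ s)
          (fderiv ℝ (localMap Φ e φ) s (surfaceCoord φ (φ.symm s) u)) (localField Φ e φ Z s)
        + fderiv ℝ τ (localMap Φ e φ s)
          (fderiv ℝ (localField Φ e φ Z) s (surfaceCoord φ (φ.symm s) u)) := by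
    have h1 := mfderiv_eq_fderiv_comp_symm hφ hs.1
      (h := fun y ↦ coord e' (Φ y) (Z y)) hD.differentiableAt u
    refine h1.trans ?_
    rw [hD.fderiv]
    exact add_comm (fderiv ℝ τ (localMap Φ e φ s)
      (fderiv ℝ (localField Φ e φ Z) s (surfaceCoord φ (φ.symm s) u))) _
  -- Both sides are compared after applying the differential of `τ`. Differentiating the transformed
  -- components (`hdc`) and transforming the Christoffel symbols (`hΓ`) produce the same second
  -- derivative of `τ`.
  apply hinj
  refine (hτd _).trans ?_
  rw [coord_inverse_apply he' hq', hdc, christoffel_eq g he' (e'.map_source hq'), cov, map_add, hΓ,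
    hτz, fderiv_localMap hΦ he hφ hs]
  have h1 : fderiv ℝ τ (localMap Φ e φ s) (coord e (Φ (φ.symm s)) (diff Φ (φ.symm s) u))
      = coord e' (Φ (φ.symm s)) (diff Φ (φ.symm s) u) := hτd _
  have h2 : fderiv ℝ τ (localMap Φ e φ s) (localField Φ e φ Z s)
      = coord e' (Φ (φ.symm s)) (Z (φ.symm s)) := hτd _
  rw [h1, h2]
  abel

theorem isUnit_det_firstFundamentalMatrix (h : IsSpacelikeImmersion g Φ) (x : S) :
    IsUnit (firstFundamentalMatrix g Φ x).det := by
  rw [isUnit_iff_ne_zero]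
  intro h0
  obtain ⟨v, hv, hv0⟩ := Matrix.exists_mulVec_eq_zero_iff.2 h0
  have h1 := val_diff_sum_basisVec g Φ x v v
  rw [hv0, dotProduct_zero] at h1
  have h2 : ∑ i, v i • basisVec x i = 0 := by
    by_contra hne
    exact (h.spacelike x _ hne).ne' h1
  have h3 : ∑ i, v i • (EuclideanSpace.single i (1 : ℝ) : E2) = 0 := h2
  refine hv (funext fun j ↦ ?_)
  have h4 := congrArg (fun a : E2 ↦ a j) h3
  fin_cases j <;> simpa using h4

theorem val_diff_tangentPart (h : IsSpacelikeImmersion g Φ) (x : S)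
    (v : TangentSpace (𝓡 4) (Φ x)) (u : TangentSpace (𝓡 2) x) :
    g.val (Φ x) (diff Φ x (tangentPart g Φ x v)) (diff Φ x u) = g.val (Φ x) v (diff Φ x u) := by
  obtain ⟨d, rfl⟩ := exists_eq_sum_basisVec x u
  have ht : tangentPart g Φ x v = ∑ i, ((firstFundamentalMatrix g Φ x)⁻¹.mulVec
      fun j ↦ g.val (Φ x) (diff Φ x (basisVec x j)) v) i • basisVec x i := rfl
  rw [g.symm, ht, val_diff_sum_basisVec, Matrix.mulVec_mulVec,
    Matrix.mul_nonsing_inv _ (isUnit_det_firstFundamentalMatrix h x), Matrix.one_mulVec, g.symm]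
  simp only [map_sum, map_smul, sum_apply, smul_apply, smul_eq_mul, dotProduct]

/-- The matrix formula and the inverse-form definition have the same inner products with all tangent
vectors. -/
theorem surfaceCoord_tangentPart (h : IsSpacelikeImmersion g Φ)
    (he : e ∈ IsManifold.maximalAtlas (𝓡 4) ∞ V) (hφ : φ ∈ IsManifold.maximalAtlas (𝓡 2) ∞ S)
    (hs : s ∈ localDomain Φ e φ) (v : TangentSpace (𝓡 4) (Φ (φ.symm s))) :
    surfaceCoord φ (φ.symm s) (tangentPart g Φ (φ.symm s) v)
      = LocalSurface.tangentPart (localMetric g e) (localMap Φ e φ) s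
          (coord e (Φ (φ.symm s)) v) := by
  symm
  refine (isImmersion_localMap h he hφ).tangentPart_eq_of_forall hs fun u ↦ ?_
  rw [← surfaceCoord_inverse_apply hφ (φ.map_target hs.1) u, fderiv_localMap h.smooth he hφ hs,
    fderiv_localMap h.smooth he hφ hs, localMap, localMetric_coord g he hs.2,
    localMetric_coord g he hs.2, val_diff_tangentPart h]

theorem coord_normalPart (h : IsSpacelikeImmersion g Φ)
    (he : e ∈ IsManifold.maximalAtlas (𝓡 4) ∞ V) (hφ : φ ∈ IsManifold.maximalAtlas (𝓡 2) ∞ S)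
    (hs : s ∈ localDomain Φ e φ) (v : TangentSpace (𝓡 4) (Φ (φ.symm s))) :
    coord e (Φ (φ.symm s)) (normalPart g Φ (φ.symm s) v)
      = LocalSurface.normalPart (localMetric g e) (localMap Φ e φ) s
          (coord e (Φ (φ.symm s)) v) := by
  rw [normalPart, map_sub, LocalSurface.normalPart, ← surfaceCoord_tangentPart h he hφ hs,
    fderiv_localMap h.smooth he hφ hs]

theorem isNormalAt_coord_iff (h : IsSpacelikeImmersion g Φ)
    (he : e ∈ IsManifold.maximalAtlas (𝓡 4) ∞ V) (hφ : φ ∈ IsManifold.maximalAtlas (𝓡 2) ∞ S)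
    (hs : s ∈ localDomain Φ e φ) (v : TangentSpace (𝓡 4) (Φ (φ.symm s))) :
    IsNormalAt (localMetric g e) (localMap Φ e φ) s (coord e (Φ (φ.symm s)) v)
      ↔ IsNormal g Φ (φ.symm s) v := by
  constructor
  · intro hn u
    have := hn (surfaceCoord φ (φ.symm s) u)
    rwa [fderiv_localMap h.smooth he hφ hs, localMap, localMetric_coord g he hs.2] at this
  · intro hn u
    rw [← surfaceCoord_inverse_apply hφ (φ.map_target hs.1) u, fderiv_localMap h.smooth he hφ hs,
      localMap, localMetric_coord g he hs.2, hn]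

theorem localField_normalCov (h : IsSpacelikeImmersion g Φ)
    (he : e ∈ IsManifold.maximalAtlas (𝓡 4) ∞ V) (hφ : φ ∈ IsManifold.maximalAtlas (𝓡 2) ∞ S)
    (hs : s ∈ localDomain Φ e φ) {N : ∀ y : S, TangentSpace (𝓡 4) (Φ y)}
    (hN : DifferentiableAt ℝ (localField Φ e φ N) s) (X : ∀ y : S, TangentSpace (𝓡 2) y) :
    localField Φ e φ (normalCov g Φ X N) s
      = LocalSurface.normalCov (localMetric g e) (leviCivita (localMetric g e)) (localMap Φ e φ)
          (localVectorField φ X) (localField Φ e φ N) s := by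
  rw [localField, normalCov, coord_normalPart h he hφ hs, coord_covAlong h.smooth he hφ hs hN]
  rfl

/-- Smooth normal fields are smooth and normal in charts. -/
theorem IsNormalFieldNear.localField (h : IsSpacelikeImmersion g Φ)
    (he : e ∈ IsManifold.maximalAtlas (𝓡 4) ∞ V) (hφ : φ ∈ IsManifold.maximalAtlas (𝓡 2) ∞ S)
    (hs : s ∈ localDomain Φ e φ) {N : ∀ y : S, TangentSpace (𝓡 4) (Φ y)}
    (hN : IsNormalFieldNear g Φ N (φ.symm s)) :
    ∀ᶠ t in 𝓝 s, ContDiffAt ℝ ∞ (localField Φ e φ N) t ∧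
      IsNormalAt (localMetric g e) (localMap Φ e φ) t (localField Φ e φ N t) := by
  filter_upwards [(φ.symm.continuousAt hs.1).eventually hN,
    (isOpen_localDomain h.smooth.continuous).mem_nhds hs] with t ht hts
  refine ⟨?_, (isNormalAt_coord_iff h he hφ hts _).2 ht.1⟩
  have h1 := (contMDiffAt_tangent_iff he hts.2 h.smooth.contMDiffAt).1 ht.2
  exact (h1.comp t (contMDiffAt_symm_of_mem_maximalAtlas hφ hts.1)).contDiffAt

theorem isNormalFieldNear_globalField (h : IsSpacelikeImmersion g Φ)
    (he : e ∈ IsManifold.maximalAtlas (𝓡 4) ∞ V) (hφ : φ ∈ IsManifold.maximalAtlas (𝓡 2) ∞ S)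
    (hs : s ∈ localDomain Φ e φ) {M : E2 → E4}
    (hM : ∀ t ∈ localDomain Φ e φ, ContDiffAt ℝ ∞ M t ∧
      IsNormalAt (localMetric g e) (localMap Φ e φ) t (M t)) :
    IsNormalFieldNear g Φ (globalField Φ e φ M) (φ.symm s) := by
  have hev : ∀ {y : S}, y ∈ φ.source → Φ y ∈ e.source →
      ∀ᶠ y in 𝓝 y, y ∈ φ.source ∧ Φ y ∈ e.source := fun {y} hy hy' ↦
    Filter.inter_mem (φ.open_source.mem_nhds hy)
      ((e.open_source.preimage h.smooth.continuous).mem_nhds hy')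
  filter_upwards [hev (φ.map_target hs.1) hs.2] with y hy
  obtain ⟨t, ht, rfl⟩ : ∃ t ∈ localDomain Φ e φ, φ.symm t = y :=
    ⟨φ y, ⟨φ.map_source hy.1, by simpa [φ.left_inv hy.1] using hy.2⟩, φ.left_inv hy.1⟩
  constructor
  · rw [← isNormalAt_coord_iff h he hφ ht]
    have := localField_globalField he ht M
    rw [localField] at this
    rw [this]
    exact (hM t ht).2
  · refine (contMDiffAt_tangent_iff he ht.2 h.smooth.contMDiffAt).2 ?_
    have h1 : ContMDiffAt (𝓡 2) 𝓘(ℝ, E4) ∞ (M ∘ φ) (φ.symm t) := by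
      refine ContMDiffAt.comp _ (I' := 𝓘(ℝ, E2)) ?_ (contMDiffAt_of_mem_maximalAtlas hφ hy.1)
      rw [φ.right_inv ht.1]
      exact (hM t ht).1.contMDiffAt
    refine h1.congr_of_eventuallyEq ?_
    filter_upwards [hev hy.1 hy.2] with y hy
    exact coord_inverse_apply he hy.2 _

/-- The Weingarten operator in charts. -/
theorem weingartenIsScalarAt_iff (h : IsSpacelikeImmersion g Φ)
    (he : e ∈ IsManifold.maximalAtlas (𝓡 4) ∞ V) (hφ : φ ∈ IsManifold.maximalAtlas (𝓡 2) ∞ S)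
    (hs : s ∈ localDomain Φ e φ) {N : ∀ y : S, TangentSpace (𝓡 4) (Φ y)}
    (hN : IsNormalFieldNear g Φ N (φ.symm s)) :
    WeingartenIsScalarAt g Φ N (φ.symm s) ↔ IsUmbilicAt (localMetric g e)
      (leviCivita (localMetric g e)) (localMap Φ e φ) s (localField Φ e φ N s) := by
  have hi := isImmersion_localMap h he hφ
  have hl := hN.localField h he hφ hs
  have hNs := hl.self_of_nhds.1
  have hy := φ.map_target hs.1
  rw [hi.isUmbilicAt_iff_tangentPart hs hNs (hl.mono fun t ht ↦ ht.2)]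
  have hw : ∀ u, surfaceCoord φ (φ.symm s) (weingarten g Φ N (φ.symm s) u)
      = LocalSurface.tangentPart (localMetric g e) (localMap Φ e φ) s
        (cov (leviCivita (localMetric g e)) (localMap Φ e φ) (localField Φ e φ N) s
          (surfaceCoord φ (φ.symm s) u)) := fun u ↦ by
    rw [weingarten, surfaceCoord_tangentPart h he hφ hs,
      coord_covAlong h.smooth he hφ hs (hNs.differentiableAt (by simp))]
  constructor
  · rintro ⟨F, hF⟩
    refine ⟨1 / 2 * F, fun u ↦ ?_⟩
    have h1 := surfaceCoord_inverse_apply hφ hy u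
    rw [← h1, ← hw, hF, map_smul]
  · rintro ⟨c, hc⟩
    -- The factor 2 compensates the normalization `A = ½ F 1`.
    refine ⟨2 * c, fun u ↦ surfaceCoord_injective hφ hy ?_⟩
    rw [hw, hc, map_smul]
    congr 1
    ring

variable [IsManifold (𝓡 2) ∞ S]

/-- The inner normal derivative is differentiated again, so its coordinate expression is needed near
`s`, not only at `s`; hence smoothness of the field on a neighbourhood. The preferred chart is
required by the bracket term. -/
theorem coord_normalCurvature (h : IsSpacelikeImmersion g Φ)
    (he : e ∈ IsManifold.maximalAtlas (𝓡 4) ∞ V) (hφ : φ = chartAt E2 (φ.symm s))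
    (hs : s ∈ localDomain Φ e φ) {N : ∀ y : S, TangentSpace (𝓡 4) (Φ y)}
    (hN : ∀ᶠ t in 𝓝 s, ContDiffAt ℝ ∞ (localField Φ e φ N) t) {X Y : ∀ y : S, TangentSpace (𝓡 2) y}
    (hX : ContDiffAt ℝ ∞ (localVectorField φ X) s) (hY : ContDiffAt ℝ ∞ (localVectorField φ Y) s) :
    coord e (Φ (φ.symm s)) (normalCurvature g Φ X Y N (φ.symm s))
      = LocalSurface.normalCurvature (localMetric g e) (leviCivita (localMetric g e))
          (localMap Φ e φ) (localVectorField φ X) (localVectorField φ Y) (localField Φ e φ N) s := by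
  have hφ' : φ ∈ IsManifold.maximalAtlas (𝓡 2) ∞ S := by
    rw [hφ]; exact IsManifold.chart_mem_maximalAtlas _
  have hi := isImmersion_localMap h he hφ'
  have hNs := hN.self_of_nhds
  have hcov : ∀ {Z : ∀ y : S, TangentSpace (𝓡 2) y}, ContDiffAt ℝ ∞ (localVectorField φ Z) s →
      localField Φ e φ (normalCov g Φ Z N) =ᶠ[𝓝 s] LocalSurface.normalCov (localMetric g e)
        (leviCivita (localMetric g e)) (localMap Φ e φ) (localVectorField φ Z) (localField Φ e φ N) ∧
      DifferentiableAt ℝ (localField Φ e φ (normalCov g Φ Z N)) s := by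
    intro Z hZ
    have h1 : localField Φ e φ (normalCov g Φ Z N) =ᶠ[𝓝 s] LocalSurface.normalCov (localMetric g e)
        (leviCivita (localMetric g e)) (localMap Φ e φ) (localVectorField φ Z)
        (localField Φ e φ N) := by
      filter_upwards [hN, hi.isOpen_source.mem_nhds hs] with t ht hts
      exact localField_normalCov h he hφ' hts (ht.differentiableAt (by simp)) Z
    exact ⟨h1, ((hi.contDiffAt_normalPart hs (hi.contDiffAt_cov hs hNs hZ)).differentiableAt
      (by simp)).congr_of_eventuallyEq h1⟩
  have key : ∀ {A B : E2 → E4} (T : E2 → E2), A =ᶠ[𝓝 s] B →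
      LocalSurface.normalCov (localMetric g e) (leviCivita (localMetric g e)) (localMap Φ e φ) T A s
      = LocalSurface.normalCov (localMetric g e) (leviCivita (localMetric g e)) (localMap Φ e φ) T B
        s := by
    intro A B T hAB
    simp only [LocalSurface.normalCov, cov, hAB.fderiv_eq, hAB.self_of_nhds]
  have e1 := localField_normalCov h he hφ' hs (hcov hY).2 X
  have e2 := localField_normalCov h he hφ' hs (hcov hX).2 Y
  have e3 := localField_normalCov h he hφ' hs (hNs.differentiableAt (by simp))
    (VectorField.mlieBracket (𝓡 2) X Y)
  have e4 : localVectorField φ (VectorField.mlieBracket (𝓡 2) X Y) s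
      = VectorField.lieBracket ℝ (localVectorField φ X) (localVectorField φ Y) s :=
    surfaceCoord_mlieBracket hs.1 hφ X Y
  rw [key _ (hcov hY).1] at e1
  rw [key _ (hcov hX).1] at e2
  rw [LocalSurface.normalCov, e4] at e3
  rw [normalCurvature, map_sub, map_sub]
  exact congrArg₂ _ (congrArg₂ _ e1 e2) e3

theorem contDiffAt_localVectorField (hφ : φ ∈ IsManifold.maximalAtlas (𝓡 2) ∞ S)
    (hs : s ∈ φ.target) {X : ∀ y : S, TangentSpace (𝓡 2) y}
    (hX : IsTangentFieldNear X (φ.symm s)) : ContDiffAt ℝ ∞ (localVectorField φ X) s := by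
  have h1 := (contMDiffAt_tangent_iff (F := fun y : S ↦ y) hφ (φ.map_target hs)
    contMDiffAt_id).1 hX.self_of_nhds
  exact (h1.comp s (contMDiffAt_symm_of_mem_maximalAtlas hφ hs)).contDiffAt

theorem isTangentFieldNear_inverse (hφ : φ ∈ IsManifold.maximalAtlas (𝓡 2) ∞ S) {y : S}
    (hy : y ∈ φ.source) (a : E2) :
    IsTangentFieldNear (fun y ↦ (surfaceCoord φ y).inverse a) y := by
  filter_upwards [φ.open_source.mem_nhds hy] with y hy
  refine (contMDiffAt_tangent_iff (F := fun y : S ↦ y) hφ hy contMDiffAt_id).2 ?_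
  refine (contMDiffAt_const (c := a)).congr_of_eventuallyEq ?_
  filter_upwards [φ.open_source.mem_nhds hy] with y hy
  exact surfaceCoord_inverse_apply hφ hy a

end Transfer

end SpacetimeSurface

/-! ### Umbilical directions and normal curvature on the surface. -/

namespace SpacetimeSurface

open LocalSurface

variable {V : Type*} [TopologicalSpace V] {S : Type*} [TopologicalSpace S] [ChartedSpace E2 S]
  {Φ : S → V} {e : OpenPartialHomeomorph V E4} {φ : OpenPartialHomeomorph S E2} {s : E2}

/-- The standard basis of the model plane. -/
def planeBasis : Module.Basis (Fin 2) ℝ E2 := (EuclideanSpace.basisFun (Fin 2) ℝ).toBasis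

/-- Writing the point as `φ.symm s` allows it to be substituted away. The preferred chart is chosen
for the sake of the Lie bracket. -/
theorem exists_surface_chart [IsManifold (𝓡 2) ∞ S] (x : S) (hx : Φ x ∈ e.source) :
    ∃ φ ∈ IsManifold.maximalAtlas (𝓡 2) ∞ S, ∃ s ∈ localDomain Φ e φ,
      φ = chartAt E2 (φ.symm s) ∧ φ.symm s = x := by
  have hl := (chartAt E2 x).left_inv (mem_chart_source E2 x)
  exact ⟨chartAt E2 x, IsManifold.chart_mem_maximalAtlas x, chartAt E2 x x,
    ⟨mem_chart_target E2 x, by simpa [hl] using hx⟩, by rw [hl], hl⟩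

theorem coord_eq_zero_iff [ChartedSpace E4 V] (he : e ∈ IsManifold.maximalAtlas (𝓡 4) ∞ V) {q : V}
    (hq : q ∈ e.source) {v : TangentSpace (𝓡 4) q} : coord e q v = 0 ↔ v = 0 :=
  ⟨fun h ↦ by rw [← inverse_coord_apply he hq v, h, map_zero], fun h ↦ by rw [h, map_zero]⟩

variable [ChartedSpace E4 V] [IsManifold (𝓡 4) ∞ V] {g : LorentzMetric V}

theorem IsUmbilicalAlongFieldNear.eventually {x : S} (hx : IsUmbilicalAlongFieldNear g Φ x) :
    ∀ᶠ y in 𝓝 x, IsUmbilicalAlongDirectionAt g Φ y := by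
  obtain ⟨N, hN, hNu⟩ := hx
  filter_upwards [eventually_eventually_nhds.2 hN, hNu] with y hy hyu
  exact ⟨N y, hyu.1, N, hy, rfl, hyu.2⟩

/-- The condition in charts depends on the normal field only through its value, so the choice of
extension is immaterial. An extension exists: the normal projection of a constant vector. -/
theorem isUmbilicalPoint_iff (h : IsSpacelikeImmersion g Φ)
    (he : e ∈ IsManifold.maximalAtlas (𝓡 4) ∞ V) (hφ : φ ∈ IsManifold.maximalAtlas (𝓡 2) ∞ S)
    (hs : s ∈ localDomain Φ e φ) (n : TangentSpace (𝓡 4) (Φ (φ.symm s))) :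
    IsUmbilicalPoint g Φ (φ.symm s) n ↔ IsNormal g Φ (φ.symm s) n ∧
      IsUmbilicAt (localMetric g e) (leviCivita (localMetric g e)) (localMap Φ e φ) s
        (coord e (Φ (φ.symm s)) n) := by
  have hi := isImmersion_localMap h he hφ
  constructor
  · rintro ⟨N, hN, rfl, hW⟩
    exact ⟨hN.self_of_nhds.1, (weingartenIsScalarAt_iff h he hφ hs hN).1 hW⟩
  · rintro ⟨hn, hu⟩
    set m := coord e (Φ (φ.symm s)) n with hm
    have hM : ∀ t ∈ localDomain Φ e φ,
        ContDiffAt ℝ ∞ (fun t ↦ LocalSurface.normalPart (localMetric g e) (localMap Φ e φ) t m) t ∧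
        IsNormalAt (localMetric g e) (localMap Φ e φ) t
          (LocalSurface.normalPart (localMetric g e) (localMap Φ e φ) t m) := fun t ht ↦
      ⟨hi.contDiffAt_normalPart ht contDiffAt_const, hi.normalPart_orthogonal ht m⟩
    have hN := isNormalFieldNear_globalField h he hφ hs hM
    have hval := localField_globalField he hs
      fun t ↦ LocalSurface.normalPart (localMetric g e) (localMap Φ e φ) t m
    rw [hi.normalPart_eq_self hs ((isNormalAt_coord_iff h he hφ hs n).2 hn)] at hval
    refine ⟨_, hN, ?_, (weingartenIsScalarAt_iff h he hφ hs hN).2 (hval ▸ hu)⟩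
    have := congrArg (coord e (Φ (φ.symm s))).inverse (hval.trans hm)
    rwa [localField, inverse_coord_apply he hs.2, inverse_coord_apply he hs.2] at this

theorem isUmbilicalAlongDirectionAt_iff_isUmbilicAt (h : IsSpacelikeImmersion g Φ)
    (he : e ∈ IsManifold.maximalAtlas (𝓡 4) ∞ V) (hφ : φ ∈ IsManifold.maximalAtlas (𝓡 2) ∞ S)
    (hs : s ∈ localDomain Φ e φ) :
    IsUmbilicalAlongDirectionAt g Φ (φ.symm s) ↔ ∃ n, n ≠ 0 ∧
      IsNormalAt (localMetric g e) (localMap Φ e φ) s n ∧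
      IsUmbilicAt (localMetric g e) (leviCivita (localMetric g e)) (localMap Φ e φ) s n := by
  constructor
  · rintro ⟨n, hne, hn⟩
    obtain ⟨hn, hu⟩ := (isUmbilicalPoint_iff h he hφ hs n).1 hn
    exact ⟨_, (coord_eq_zero_iff he hs.2).not.2 hne, (isNormalAt_coord_iff h he hφ hs n).2 hn, hu⟩
  · rintro ⟨n, hne, hn, hu⟩
    obtain ⟨v, rfl⟩ : ∃ v, coord e (Φ (φ.symm s)) v = n := ⟨_, coord_inverse_apply he hs.2 n⟩
    exact ⟨v, (coord_eq_zero_iff he hs.2).not.1 hne, (isUmbilicalPoint_iff h he hφ hs v).2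
      ⟨(isNormalAt_coord_iff h he hφ hs v).1 hn, hu⟩⟩

variable [IsManifold (𝓡 2) ∞ S]

/-- In a spacetime whose curvature preserves orthogonal splittings, a spacelike surface is umbilical
along a normal direction at a point iff the normal curvature vanishes there. -/
theorem isUmbilicalAlongDirectionAt_iff
    (hg : IsLocallyConformallyFlat g ∨ ∃ K : ℝ, HasConstantCurvature g K)
    (h : IsSpacelikeImmersion g Φ) (x : S) :
    IsUmbilicalAlongDirectionAt g Φ x ↔ NormalCurvatureVanishesAt g Φ x := by
  obtain ⟨e, he, hx, hR⟩ := exists_chart_curvaturePreservesSplitting g hg (Φ x)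
  obtain ⟨φ, hφ, s, hs, hφs, rfl⟩ := exists_surface_chart (Φ := Φ) x hx
  have hi := isImmersion_localMap h he hφ
  rw [isUmbilicalAlongDirectionAt_iff_isUmbilicAt h he hφ hs]
  constructor
  · rintro ⟨n, hne, hn, hu⟩ X Y N hX hY hN
    have hl := hN.localField h he hφ hs
    have hX' := contDiffAt_localVectorField hφ hs.1 hX
    have hY' := contDiffAt_localVectorField hφ hs.1 hY
    rw [← coord_eq_zero_iff he hs.2, coord_normalCurvature h he hφs hs (hl.mono fun t ht ↦ ht.1)
      hX' hY']
    exact hi.normalCurvature_eq_zero hs (by simp) (by simp)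
      ((isMetricOn_localMetric g he).nondegenerate _ (hi.mapsTo hs)) hR hn hne hu
      hl.self_of_nhds.1 (hl.mono fun t ht ↦ ht.2) hX' hY'
  · intro hvan
    -- The hypothesis is applied to an extension of `n₁` by normal projection and to the coordinate
    -- fields of `φ`, which at `s` are the basis vectors.
    have hrel : ∀ n₁ n₂, IsNormalAt (localMetric g e) (localMap Φ e φ) s n₁ →
        IsNormalAt (localMetric g e) (localMap Φ e φ) s n₂ →
        localMetric g e (localMap Φ e φ s) n₁ (shear (localMetric g e)
            (leviCivita (localMetric g e)) (localMap Φ e φ) planeBasis 0 s)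
          * localMetric g e (localMap Φ e φ s) n₂ (shear (localMetric g e)
            (leviCivita (localMetric g e)) (localMap Φ e φ) planeBasis 1 s)
        = localMetric g e (localMap Φ e φ s) n₂ (shear (localMetric g e)
            (leviCivita (localMetric g e)) (localMap Φ e φ) planeBasis 0 s)
          * localMetric g e (localMap Φ e φ s) n₁ (shear (localMetric g e)
            (leviCivita (localMetric g e)) (localMap Φ e φ) planeBasis 1 s) := by
      intro n₁ n₂ hn₁ hn₂
      set M : E2 → E4 :=
        fun t ↦ LocalSurface.normalPart (localMetric g e) (localMap Φ e φ) t n₁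
      have hM : ∀ t ∈ localDomain Φ e φ, ContDiffAt ℝ ∞ M t ∧
          IsNormalAt (localMetric g e) (localMap Φ e φ) t (M t) := fun t ht ↦
        ⟨hi.contDiffAt_normalPart ht contDiffAt_const, hi.normalPart_orthogonal ht n₁⟩
      have hMs : M s = n₁ := hi.normalPart_eq_self hs hn₁
      have hN := isNormalFieldNear_globalField h he hφ hs hM
      have hl := hN.localField h he hφ hs
      have hX (a : E2) := isTangentFieldNear_inverse hφ (φ.map_target hs.1) a
      have h0 := hvan _ _ _ (hX (planeBasis 0)) (hX (planeBasis 1)) hN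
      rw [← coord_eq_zero_iff he hs.2, coord_normalCurvature h he hφs hs
        (hl.mono fun t ht ↦ ht.1) (contDiffAt_localVectorField hφ hs.1 (hX _))
        (contDiffAt_localVectorField hφ hs.1 (hX _))] at h0
      have hval := localField_globalField he hs M
      have hrel := hi.shear_mul_shear hs planeBasis hR hl.self_of_nhds.1
        (hl.mono fun t ht ↦ ht.2) (contDiffAt_localVectorField hφ hs.1 (hX _))
        (contDiffAt_localVectorField hφ hs.1 (hX _))
        (surfaceCoord_inverse_apply hφ (φ.map_target hs.1) _)
        (surfaceCoord_inverse_apply hφ (φ.map_target hs.1) _) h0 hn₂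
      rwa [hval, hMs] at hrel
    -- At a totally umbilical point any nonzero normal vector serves. Otherwise the kernel
    -- construction applies.
    by_cases hall : ∀ n, IsNormalAt (localMetric g e) (localMap Φ e φ) s n →
        IsUmbilicAt (localMetric g e) (leviCivita (localMetric g e)) (localMap Φ e φ) s n
    · obtain ⟨n, hn, hne⟩ := hi.exists_independent_normal hs (by simp) (by simp) 0
      exact ⟨n, by simpa using hne 0, hn, hall n hn⟩
    · push Not at hall
      obtain ⟨n, hn, hu⟩ := hall
      obtain ⟨M, hM, hMs, hMu⟩ := hi.exists_umbilic_field hs planeBasis (by simp) hn hu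
      exact ⟨M s, hMs, (hM s hs).2, hMu s hs hrel⟩

/-- Around a point which is not totally umbilical, the pointwise umbilic directions form a smooth
normal field. -/
theorem isUmbilicalAlongFieldNear_of_eventually (h : IsSpacelikeImmersion g Φ) {x : S}
    (hx : ¬ IsTotallyUmbilicalAt g Φ x) (hev : ∀ᶠ y in 𝓝 x, IsUmbilicalAlongDirectionAt g Φ y) :
    IsUmbilicalAlongFieldNear g Φ x := by
  have he : chartAt E4 (Φ x) ∈ IsManifold.maximalAtlas (𝓡 4) ∞ V :=
    IsManifold.chart_mem_maximalAtlas _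
  have hxe := mem_chart_source E4 (Φ x)
  generalize chartAt E4 (Φ x) = e at he hxe
  obtain ⟨φ, hφ, s, hs, -, rfl⟩ := exists_surface_chart (Φ := Φ) x hxe
  have hi := isImmersion_localMap h he hφ
  unfold IsTotallyUmbilicalAt at hx
  push Not at hx
  obtain ⟨n, hn, hu⟩ := hx
  rw [isUmbilicalPoint_iff h he hφ hs, not_and] at hu
  obtain ⟨M, hM, hMs, hMu⟩ := hi.exists_umbilic_field hs planeBasis (by simp)
    ((isNormalAt_coord_iff h he hφ hs n).2 hn) (hu hn)
  refine ⟨globalField Φ e φ M, isNormalFieldNear_globalField h he hφ hs hM, ?_⟩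
  have hne : ∀ᶠ y in 𝓝 (φ.symm s), M (φ y) ≠ 0 := by
    have hc : ContinuousAt (fun y ↦ M (φ y)) (φ.symm s) := by
      refine ContinuousAt.comp (g := M) ?_ (φ.continuousAt (φ.map_target hs.1))
      rw [φ.right_inv hs.1]
      exact (hM s hs).1.continuousAt
    refine hc.eventually_ne ?_
    rwa [φ.right_inv hs.1]
  filter_upwards [hne, hev, φ.open_source.mem_nhds (φ.map_target hs.1),
    (e.open_source.preimage h.smooth.continuous).mem_nhds hs.2] with y hy0 hyu hy hye
  obtain ⟨t, ht, rfl⟩ : ∃ t ∈ localDomain Φ e φ, φ.symm t = y :=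
    ⟨φ y, ⟨φ.map_source hy, by simpa [φ.left_inv hy] using hye⟩, φ.left_inv hy⟩
  rw [φ.right_inv ht.1] at hy0
  have hval := localField_globalField he ht M
  constructor
  · exact (coord_eq_zero_iff he ht.2).not.1 (show localField Φ e φ _ t ≠ 0 from hval ▸ hy0)
  · rw [weingartenIsScalarAt_iff h he hφ ht (isNormalFieldNear_globalField h he hφ ht hM), hval]
    obtain ⟨n, hne, hn, hu⟩ := (isUmbilicalAlongDirectionAt_iff_isUmbilicAt h he hφ ht).1 hyu
    -- An umbilical direction at each nearby point already forces proportionality of the shears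
    -- there, so no curvature assumption enters.
    exact hMu t ht fun n₁ n₂ hn₁ hn₂ ↦
      hi.shear_mul_shear_of_isUmbilicAt ht planeBasis (by simp) hn hne hu hn₁ hn₂

end SpacetimeSurface

end

open SpacetimeSurface in
theorem corollary1
    {V : Type*} [TopologicalSpace V] [ChartedSpace E4 V] [IsManifold (𝓡 4) ∞ V]
    {S : Type*} [TopologicalSpace S] [ChartedSpace E2 S] [IsManifold (𝓡 2) ∞ S]
    (g : LorentzMetric V)
    (hg : IsLocallyConformallyFlat g ∨ ∃ K : ℝ, HasConstantCurvature g K)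
    (Φ : S → V) (hΦ : IsSpacelikeImmersion g Φ) :
    ((∀ x : S, IsUmbilicalAlongDirectionAt g Φ x) ↔ ∀ x : S, NormalCurvatureVanishesAt g Φ x) ∧
    (∀ x : S, IsUmbilicalAlongDirectionAt g Φ x ↔ NormalCurvatureVanishesAt g Φ x) ∧
    (∀ x : S, ¬ IsTotallyUmbilicalAt g Φ x →
      (IsUmbilicalAlongFieldNear g Φ x ↔ ∀ᶠ y in 𝓝 x, NormalCurvatureVanishesAt g Φ y)) := by
  have h := isUmbilicalAlongDirectionAt_iff hg hΦ
  refine ⟨forall_congr' h, h, fun x hx ↦ ?_⟩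
  -- The pointwise equivalence holds at every point, so vanishing of `R^⊥` near `x` is the same as
  -- umbilicity along some direction at each point near `x`.
  rw [← Filter.eventually_congr (.of_forall h)]
  exact ⟨fun hf ↦ hf.eventually, isUmbilicalAlongFieldNear_of_eventually hΦ hx⟩
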